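/- Let $SL_2=SL_2(\mathbb C)$ act on $(\mathbb C^2)^{\oplus 6}=\mathrm{Mat}_{2\times 6}(\mathbb C)$ by left multiplication, and let $X=(x_{kj})$ be the generic $2\times 6$ matrix. For $d\ge 0$ let $V_d=\mathbb C[x,y]_d$ be the irreducible representation of dimension $d+1$. For an $SL_2$-stable closed subscheme $Y\subset \mathrm{Mat}_{2\times 6}$ let $\mathrm{Hilb}^{SL_2}(Y)$ denote the invariant Hilbert scheme with Hilbert function $h(d)=d+1$: its points with values in a commutative $\mathbb C$-algebra $A$ are the $SL_2$-stable ideals $I\subset A[x_{11},\dots,x_{26}]$ defining closed subschemes of $Y\times\operatorname{Spec}A$ such that every module of covariants $\mathrm{Hom}^{SL_2}(V_d,A[x_{kj}]/I)$ is a locally free $A$-module of rank $d+1$. The group $\mathbb C^*$ acts on $\mathrm{Mat}_{2\times 6}$ by scalar multiplication and hence on these Hilbert schemes (when $Y$ is a cone). Let $J=\begin{pmatrix}0&1\\-1&0\end{pmatrix}$, $Q=\begin{pmatrix}0&I_3\\I_3&0\end{pmatrix}$, $\mu(M)=MQM^tJ$, and let $\mu^{-1}(0)$ be the scheme-theoretic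 zero fibre. Let $\perp$ and "isotropic" refer to the symmetric bilinear form $\langle v,w\rangle=v^tQw$. For a commutative $\mathbb C$-algebra $A$ let $Gr(2,\mathbb C^6)(A)$ be the set of submodules $U\subset A^6$ such that $A^6/U$ is locally free of rank $4$, and let $OG(2,\mathbb C^6)(A)$ be the subset of those $U$ on which the form vanishes identically. For $U\in Gr(2,\mathbb C^6)(A)$ let $I_U\subset A[x_{kj}]$ be the ideal generated by the two entries of $Xv$ for all $v\in U^\perp$ and by all $2\times 2$ minors $\Lambda^{ij}$ of $X$ (columns $i,j$). 1. For every commutative $\mathbb C$-algebra $A$, the map $U\mapsto I_U$ is a bijection from $Gr(2,\mathbb C^6)(A)$ onto the set of $\mathbb C^*$-fixed $A$-points of $\mathrm{Hilb}^{SL_2}((\mathbb C^2)^{\oplus 6})$, and it restricts to a bijection from $OG(2,\mathbb C^6)(A)$ onto the set of $\mathbb C^*$-fixed $A$-points of $\mathrm{Hilb}^{SL_2}(\mu^{-1}(0))$. These bijections are compatible with base change along homomorphisms $A\to B$ of $\mathbb C$-algebras. Hence the $\mathbb C^*$-fixed locus of $\mathrm{Hilb}^{SL_2}((\mathbb C^2)^{\oplus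 6})$ is isomorphic to $Gr(2,\mathbb C^6)$, and that of $\mathrm{Hilb}^{SL_2}(\mu^{-1}(0))$ to $OG(2,\mathbb C^6)$. 2. In particular, for $A=\mathbb C$, the map $U\mapsto I_U$ is a bijection from the set of $2$-dimensional subspaces of $\mathbb C^6$ (respectively, of isotropic ones) onto the set of $\mathbb C^*$-fixed closed points of $\mathrm{Hilb}^{SL_2}((\mathbb C^2)^{\oplus 6})$ (respectively, of $\mathrm{Hilb}^{SL_2}(\mu^{-1}(0))$). 3. The $\mathbb C^*$-fixed closed points of $\mathrm{Hilb}^{SL_2}((\mathbb C^2)^{\oplus 6})$ are exactly the ideals $I\subset\mathbb C[x_{11},\dots,x_{26}]$ for which there are a $4$-dimensional subspace $V\subset\mathbb C^6$ and indices $i,j$ with $V+\langle e_i,e_j\rangle=\mathbb C^6$ such that $I$ is generated by the two entries of $Xv$ for all $v\in V$ together with the single minor $\Lambda^{ij}$. Those lying in $\mathrm{Hilb}^{SL_2}(\mu^{-1}(0))$ are exactly the ideals of this form for which, in addition, $V^\perp$ is isotropic. -/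

import Mathlib

open scoped Matrix MatrixGroups

universe u

namespace SlTwoHilb

/-! ### The representation `(ℂ²)^{⊕6} = Mat_{2×6}` and the actions of `SL₂` and `ℂ*` -/

/-- The coordinate ring `A[x₁₁, …, x₂₆]` of the space of `2 × 6` matrices over a ring `A`;
the variable indexed by `(k, j)` is the entry in row `k` and column `j`. -/
abbrev CoordRing (A : Type u) [CommRing A] : Type u := MvPolynomial (Fin 2 × Fin 6) A

/-- The generic `2 × 6` matrix `X = (x_{kj})`. -/
noncomputable abbrev genMat (A : Type u) [CommRing A] :
    Matrix (Fin 2) (Fin 6) (CoordRing A) :=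
  Matrix.mvPolynomialX (Fin 2) (Fin 6) A

/-- The action of `SL₂(ℂ)` on functions induced by left multiplication on `2 × 6` matrices:
`(g • f)(M) = f(g⁻¹ M)`. -/
noncomputable def slAct (A : Type u) [CommRing A] [Algebra ℂ A] :
    SL(2, ℂ) →* (CoordRing A →ₐ[A] CoordRing A) where
  toFun g := MvPolynomial.aeval fun kj =>
    (((g⁻¹ : SL(2, ℂ)) : Matrix (Fin 2) (Fin 2) ℂ).map (algebraMap ℂ (CoordRing A)) *
      genMat A) kj.1 kj.2
  map_one' := by
    refine MvPolynomial.algHom_ext fun kj => ?_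
    rw [MvPolynomial.aeval_X, inv_one, Matrix.SpecialLinearGroup.coe_one,
      Matrix.map_one _ (map_zero _) (map_one _), Matrix.one_mul]
    rfl
  map_mul' g h := by
    refine MvPolynomial.algHom_ext fun kj => ?_
    obtain ⟨k, j⟩ := kj
    simp only [mul_inv_rev, Matrix.SpecialLinearGroup.coe_mul, Matrix.map_mul, Matrix.mul_assoc,
      AlgHom.mul_apply, MvPolynomial.aeval_X]
    rw [Matrix.mul_apply, Matrix.mul_apply, map_sum]
    refine Finset.sum_congr rfl fun l _ => ?_
    simp only [Matrix.map_apply, map_mul, Matrix.mvPolynomialX_apply, MvPolynomial.aeval_X,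
      MvPolynomial.algebraMap_eq, MvPolynomial.algebraMap_apply, MvPolynomial.algHom_C]

/-- The action of `ℂ*` on functions induced by scalar multiplication on `2 × 6` matrices:
`(t • f)(M) = f(t⁻¹ M)`. -/
noncomputable def scaleAct (A : Type u) [CommRing A] [Algebra ℂ A] :
    ℂˣ →* (CoordRing A →ₐ[A] CoordRing A) where
  toFun t := MvPolynomial.aeval fun kj =>
    algebraMap ℂ (CoordRing A) ((t⁻¹ : ℂˣ) : ℂ) * MvPolynomial.X kj
  map_one' := by
    ext kj
    simp
  map_mul' s t := by
    refine MvPolynomial.algHom_ext fun kj => ?_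
    simp only [mul_inv_rev, Units.val_mul, AlgHom.mul_apply, MvPolynomial.aeval_X, map_mul,
      MvPolynomial.algebraMap_eq, MvPolynomial.algebraMap_apply, MvPolynomial.algHom_C]
    ring

/-! ### The irreducible representations of `SL₂` -/

/-- The action of `SL₂(ℂ)` on `ℂ[x, y]`: `(g • p)(w) = p(g⁻¹ w)`. -/
noncomputable def binAct :
    SL(2, ℂ) →* (MvPolynomial (Fin 2) ℂ →ₐ[ℂ] MvPolynomial (Fin 2) ℂ) where
  toFun g := MvPolynomial.aeval
    ((((g⁻¹ : SL(2, ℂ)) : Matrix (Fin 2) (Fin 2) ℂ).map MvPolynomial.C) *ᵥ MvPolynomial.X)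
  map_one' := by
    refine MvPolynomial.algHom_ext fun k => ?_
    rw [MvPolynomial.aeval_X, inv_one, Matrix.SpecialLinearGroup.coe_one,
      Matrix.map_one _ (map_zero _) (map_one _), Matrix.one_mulVec]
    rfl
  map_mul' g h := by
    refine MvPolynomial.algHom_ext fun k => ?_
    simp only [mul_inv_rev, Matrix.SpecialLinearGroup.coe_mul, Matrix.map_mul,
      ← Matrix.mulVec_mulVec, AlgHom.mul_apply, MvPolynomial.aeval_X]
    rw [Matrix.mulVec, Matrix.mulVec, dotProduct, dotProduct, map_sum]
    refine Finset.sum_congr rfl fun l _ => ?_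
    simp only [Matrix.map_apply, map_mul, MvPolynomial.aeval_X, MvPolynomial.algHom_C,
      MvPolynomial.algebraMap_eq]

/-- The space `V_d = ℂ[x, y]_d` of binary forms of degree `d`. -/
abbrev BinForm (d : ℕ) : Type := MvPolynomial.homogeneousSubmodule (Fin 2) ℂ d

lemma binAct_mem (d : ℕ) (g : SL(2, ℂ)) (p : MvPolynomial (Fin 2) ℂ)
    (hp : p ∈ MvPolynomial.homogeneousSubmodule (Fin 2) ℂ d) :
    (binAct g).toLinearMap p ∈ MvPolynomial.homogeneousSubmodule (Fin 2) ℂ d := by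
  rw [MvPolynomial.mem_homogeneousSubmodule] at hp ⊢
  rw [← one_mul d]
  refine hp.aeval _ fun k => ?_
  rw [Matrix.mulVec, dotProduct]
  refine MvPolynomial.IsHomogeneous.sum _ _ _ fun l _ => ?_
  exact zero_add 1 ▸ (MvPolynomial.isHomogeneous_C (Fin 2)
    (((g⁻¹ : SL(2, ℂ)) : Matrix (Fin 2) (Fin 2) ℂ) k l)).mul (MvPolynomial.isHomogeneous_X ℂ l)

/-- The irreducible representation `V_d = ℂ[x, y]_d` of `SL₂(ℂ)`. -/
noncomputable def binRep (d : ℕ) : Representation ℂ SL(2, ℂ) (BinForm d) where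
  toFun g := (binAct g).toLinearMap.restrict (binAct_mem d g)
  map_one' := by
    ext p
    simp [LinearMap.restrict_apply]
  map_mul' g h := by
    ext p
    simp [LinearMap.restrict_apply]

/-! ### The invariant Hilbert functor

A closed subscheme of `Mat_{2×6} × Spec A` is an ideal of `CoordRing A`. -/

/-- `I` is stable under the action of `SL₂`. -/
def SlStable {A : Type u} [CommRing A] [Algebra ℂ A] (I : Ideal (CoordRing A)) : Prop :=
  ∀ g : SL(2, ℂ), I ≤ I.comap (slAct A g)

/-- The action of `SL₂(ℂ)` on the coordinate ring `A[X] / I` of an invariant closed subscheme. -/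
noncomputable def slActQuot {A : Type u} [CommRing A] [Algebra ℂ A] (I : Ideal (CoordRing A))
    (hI : SlStable I) (g : SL(2, ℂ)) : (CoordRing A ⧸ I) →ₐ[A] (CoordRing A ⧸ I) :=
  Ideal.quotientMapₐ I (slAct A g) (hI g)

/-- The module of covariants `F_d = Hom^{SL₂}(V_d, A[X] / I)`. -/
noncomputable def covariants {A : Type u} [CommRing A] [Algebra ℂ A] (I : Ideal (CoordRing A))
    (hI : SlStable I) (d : ℕ) : Submodule A (BinForm d →ₗ[ℂ] (CoordRing A ⧸ I)) where
  carrier := {φ | ∀ (g : SL(2, ℂ)) (p : BinForm d), φ (binRep d g p) = slActQuot I hI g (φ p)}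
  add_mem' := by
    intro φ ψ hφ hψ g p
    simp [hφ g p, hψ g p]
  zero_mem' := by
    intro g p
    simp
  smul_mem' := by
    intro a φ hφ g p
    simp [hφ g p]

/-- `M` is locally free of rank `n` over `A`, i.e. finitely generated projective of constant
rank `n`. -/
def IsLocallyFreeOfRank (A : Type u) [CommRing A] (M : Type u) [AddCommGroup M] [Module A M]
    (n : ℕ) : Prop :=
  Module.Finite A M ∧ Module.Projective A M ∧ ∀ p, Module.rankAtStalk (R := A) M p = n

/-- The `A`-valued points of the invariant Hilbert scheme `Hilb^{SL₂}_h(X)`, where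
`X ⊆ Mat_{2×6}` is the closed subscheme cut out by the ideal `K`: the `SL₂`-invariant closed
subschemes of `X × Spec A` all of whose modules of covariants `F_d` are locally free of rank
`h d`. (These families are then automatically flat over `A`.) -/
def invHilb (h : ℕ → ℕ) (K : Ideal (CoordRing ℂ)) (A : Type u) [CommRing A] [Algebra ℂ A] :
    Set (Ideal (CoordRing A)) :=
  {I | K.map (MvPolynomial.map (algebraMap ℂ A)) ≤ I ∧
    ∃ hI : SlStable I, ∀ d : ℕ, IsLocallyFreeOfRank A (covariants I hI d) (h d)}

/-- The `SL₂`-Hilbert scheme: the Hilbert function is `h(d) = dim V_d = d + 1`. -/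
def slHilb (K : Ideal (CoordRing ℂ)) (A : Type u) [CommRing A] [Algebra ℂ A] :
    Set (Ideal (CoordRing A)) :=
  invHilb (fun d => d + 1) K A

/-- The `A`-valued points of the `SL₂`-Hilbert scheme which are fixed by the action
`Z ↦ tZ` of `ℂ*`. -/
def slHilbFixed (K : Ideal (CoordRing ℂ)) (A : Type u) [CommRing A] [Algebra ℂ A] :
    Set (Ideal (CoordRing A)) :=
  {I | I ∈ slHilb K A ∧ ∀ t : ℂˣ, I.map (scaleAct A t) = I}

/-! ### The quadratic form and the zero fibre of the moment map -/

/-- The symmetric matrix `Q = (0 I₃; I₃ 0)`. -/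
def matQ (A : Type u) [CommRing A] : Matrix (Fin 6) (Fin 6) A :=
  !![0, 0, 0, 1, 0, 0;
     0, 0, 0, 0, 1, 0;
     0, 0, 0, 0, 0, 1;
     1, 0, 0, 0, 0, 0;
     0, 1, 0, 0, 0, 0;
     0, 0, 1, 0, 0, 0]

/-- The symplectic matrix `J = (0 1; -1 0)`. -/
def matJ (A : Type u) [CommRing A] : Matrix (Fin 2) (Fin 2) A :=
  !![0, 1; -1, 0]

/-- The ideal of the scheme-theoretic zero fibre of the moment map `μ(M) = M Q Mᵗ J`. -/
noncomputable def muIdeal : Ideal (CoordRing ℂ) :=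
  Ideal.span {f | ∃ k l : Fin 2,
    f = (genMat ℂ * matQ (CoordRing ℂ) * (genMat ℂ)ᵀ * matJ (CoordRing ℂ)) k l}

/-- The bilinear form `⟨v, w⟩ = vᵗ Q w` on `A⁶`. -/
noncomputable def formQ (A : Type u) [CommRing A] : LinearMap.BilinForm A (Fin 6 → A) :=
  Matrix.toBilin' (matQ A)

/-! ### The Grassmannian of planes and the associated ideals -/

/-- The `A`-valued points of the Grassmannian `Gr(2, ℂ⁶)`: the submodules of `A⁶` which are
direct summands of rank `2`, i.e. those with locally free quotient of rank `4`. -/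
def planes (A : Type u) [CommRing A] : Set (Submodule A (Fin 6 → A)) :=
  {U | IsLocallyFreeOfRank A ((Fin 6 → A) ⧸ U) 4}

/-- `U` is isotropic for the form `Q`. -/
def IsIsotropic {A : Type u} [CommRing A] (U : Submodule A (Fin 6 → A)) : Prop :=
  ∀ u ∈ U, ∀ v ∈ U, formQ A u v = 0

/-- The `A`-valued points of the Grassmannian of isotropic planes in `ℂ⁶`. -/
def isoPlanes (A : Type u) [CommRing A] : Set (Submodule A (Fin 6 → A)) :=
  {U | U ∈ planes A ∧ IsIsotropic U}

/-- The ideal generated by the linear forms `M ↦ (M v)_k` with `v ∈ V` and `k = 1, 2`; it is the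
ideal of the matrices `M` that vanish on `V`. -/
noncomputable def linIdeal {A : Type u} [CommRing A] (V : Submodule A (Fin 6 → A)) :
    Ideal (CoordRing A) :=
  Ideal.span {f | ∃ v ∈ V, ∃ k : Fin 2, f = (genMat A *ᵥ fun j => MvPolynomial.C (v j)) k}

/-- The `2 × 2` minor `Λ^{ij}` of the columns `i` and `j` of the generic matrix. -/
noncomputable def minor (A : Type u) [CommRing A] (i j : Fin 6) : CoordRing A :=
  ((genMat A).submatrix id ![i, j]).det

/-- The ideal attached to a plane `U`: it is generated by the linear forms belonging to the
orthogonal complement `V = U^⊥` with respect to `Q` and by all `2 × 2` minors. -/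
noncomputable def planeIdeal {A : Type u} [CommRing A] (U : Submodule A (Fin 6 → A)) :
    Ideal (CoordRing A) :=
  linIdeal ((formQ A).orthogonal U) ⊔ Ideal.span {f | ∃ i j : Fin 6, f = minor A i j}

/-- The base change to `B` of a submodule of `A⁶`. -/
def baseChange {A B : Type u} [CommRing A] [CommRing B] (f : A →+* B)
    (U : Submodule A (Fin 6 → A)) : Submodule B (Fin 6 → B) :=
  Submodule.span B {w | ∃ v ∈ U, w = fun j => f (v j)}

end SlTwoHilb

/-! An ideal `I` stable under `SL₂(ℂ)` and `ℂ*` is stable under all substitutions `X ↦ hX` with `h`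
invertible, because `h` is a scalar times a matrix of determinant one. Rank one of the module of
invariants says that the invariants of `A[X]/I` are `A`. Hence each minor is congruent to a
constant, and comparing weights under scaling puts the minor itself into `I`
(`IsConical.minorIdeal_le`).

So `I` defines a subscheme of the cone of matrices `w bᵗ` of rank at most one. The coordinate ring
of this cone is the sum of the products `V_d ⊗ A[z₁, …, z₆]_d` (`mem_minorIdeal_of_seg_eq_zero` for
the injectivity of `seg` modulo minors, `exists_seg_eq` for the image). Therefore `I` is determined
by the ideal `N = rowIdeal I` of polynomials in the first row (`IsConical.mem_iff`), and its
covariants of type `V_d` form the degree `d` part of `A[z]/N`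
(`IsConical.nonempty_covariants_equiv`).

The Hilbert function now asks that `(A[z]/N)_d` be locally free of rank `d + 1`. For `d = 1` the
linear forms in `N` make up a submodule `V` of `A⁶` whose quotient has rank two. The symmetric
powers of this quotient have rank `d + 1` (`isLocallyFreeOfRank_gradedQuot`) and surject onto
`(A[z]/N)_d`. A surjection between locally free modules of equal rank is bijective, so `N` has no
further relations in any degree, and `I` is the ideal of the plane `U = V^⊥`
(`exists_planeIdeal_eq`).

The rows of the matrices in this subscheme lie in `QU`, and `Q` is an isometry, so the moment map
vanishes there exactly when `U` is isotropic. Direct summands of `A⁶` are treated throughout as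
images of idempotent matrices: complements, ranks and base change become matrix identities. -/

namespace SlTwoHilb

/-! ### Separation by complex values -/

/-- If a polynomial expression in a complex parameter takes values in a subspace for infinitely
many parameters, then its coefficients lie in this subspace. -/
lemma mem_of_forall_sum_pow_smul_mem {V : Type*} [AddCommGroup V] [Module ℂ V]
    (W : Submodule ℂ V) {S : Set ℂ} (hS : S.Infinite) (n : ℕ) (v : ℕ → V)
    (h : ∀ s ∈ S, ∑ i ∈ Finset.range n, s ^ i • v i ∈ W) {i : ℕ} (hi : i < n) : v i ∈ W := by
  by_contra hv
  -- A functional that kills `W` but not `v i` turns the hypothesis into a complex polynomial with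
  -- infinitely many roots and a nonzero coefficient.
  obtain ⟨f, hf, hW⟩ := Submodule.exists_le_ker_of_notMem hv
  have hq : (∑ j ∈ Finset.range n, Polynomial.C (f (v j)) * Polynomial.X ^ j) = 0 := by
    refine Polynomial.eq_zero_of_infinite_isRoot _ (hS.mono fun s hs => ?_)
    have := hW (h s hs)
    rw [LinearMap.mem_ker, map_sum] at this
    rw [Set.mem_ofPred_eq, Polynomial.IsRoot.def, Polynomial.eval_finsetSum, ← this]
    refine Finset.sum_congr rfl fun j _ => ?_
    rw [Polynomial.eval_mul, Polynomial.eval_C, Polynomial.eval_pow, Polynomial.eval_X, map_smul,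
      smul_eq_mul, mul_comm]
  have := congrArg (fun q => Polynomial.coeff q i) hq
  simp only [Polynomial.finsetSum_coeff, Polynomial.coeff_C_mul, Polynomial.coeff_X_pow, mul_ite,
    mul_one, mul_zero, Finset.sum_ite_eq, Finset.mem_range, hi, if_true,
    Polynomial.coeff_zero] at this
  exact hf this

lemma infinite_compl_zero : ({0}ᶜ : Set ℂ).Infinite :=
  (Set.finite_singleton 0).infinite_compl

/-- The evaluation of a polynomial in two variables over a `ℂ`-algebra at a complex point. -/
noncomputable def evalAt {B : Type*} [CommRing B] [Algebra ℂ B] (a : Fin 2 → ℂ) :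
    MvPolynomial (Fin 2) B →ₐ[B] B :=
  MvPolynomial.aeval fun k => algebraMap ℂ B (a k)

/-- Complex functionals on `B`, applied to the coefficients, reduce the claim to complex
polynomials; the factor `X 0` absorbs the points with `a 0 = 0`. The points with `a 0 ≠ 0` are those
that occur as first column of a lower triangular invertible matrix. -/
lemma eq_zero_of_evalAt_eq_zero {B : Type*} [CommRing B] [Algebra ℂ B]
    {f : MvPolynomial (Fin 2) B} (h : ∀ a : Fin 2 → ℂ, a 0 ≠ 0 → evalAt a f = 0) : f = 0 := by
  ext m
  rw [MvPolynomial.coeff_zero, ← Module.forall_dual_apply_eq_zero_iff ℂ]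
  intro l
  let g : MvPolynomial (Fin 2) ℂ :=
    ∑ n ∈ f.support, MvPolynomial.monomial n (l (MvPolynomial.coeff n f))
  have hg : MvPolynomial.X 0 * g = 0 := by
    refine MvPolynomial.funext fun a => ?_
    by_cases ha : a 0 = 0
    · simp [ha]
    have h1 : MvPolynomial.eval a g = l (evalAt a f) := by
      rw [evalAt, MvPolynomial.aeval_def, MvPolynomial.eval₂_eq', map_sum, map_sum]
      refine Finset.sum_congr rfl fun n _ => ?_
      rw [MvPolynomial.eval_monomial, Algebra.algebraMap_self, RingHom.id_apply,
        Finsupp.prod_fintype _ _ (by simp)]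
      rw [mul_comm (MvPolynomial.coeff n f), mul_comm, ← smul_eq_mul, ← map_smul]
      simp [Algebra.smul_def]
    simp [h1, h a ha]
  have hg0 : g = 0 := by simpa using hg
  have h2 : MvPolynomial.coeff m g = l (MvPolynomial.coeff m f) := by
    simp only [g, MvPolynomial.coeff_sum, MvPolynomial.coeff_monomial]
    rw [Finset.sum_ite_eq']
    split_ifs with hm
    · rfl
    · rw [MvPolynomial.notMem_support_iff.1 hm, map_zero]
  rw [← h2, hg0, MvPolynomial.coeff_zero]

/-! ### Linear substitutions -/

/-- The linear substitution `x_k ↦ ∑ h_{kl} x_l` in two variables. -/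
noncomputable def substBin (B : Type*) [CommRing B] [Algebra ℂ B] (h : Matrix (Fin 2) (Fin 2) ℂ) :
    MvPolynomial (Fin 2) B →ₐ[B] MvPolynomial (Fin 2) B :=
  MvPolynomial.aeval fun k =>
    ∑ l, MvPolynomial.C (algebraMap ℂ B (h k l)) * MvPolynomial.X l

lemma evalAt_substBin {B : Type*} [CommRing B] [Algebra ℂ B] (h : Matrix (Fin 2) (Fin 2) ℂ)
    (a : Fin 2 → ℂ) (f : MvPolynomial (Fin 2) B) :
    evalAt a (substBin B h f) = evalAt (h *ᵥ a) f := by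
  have : (evalAt a).comp (substBin B h) = evalAt (h *ᵥ a) := by
    refine MvPolynomial.algHom_ext fun k => ?_
    simp [evalAt, substBin, Matrix.mulVec, dotProduct]
  exact DFunLike.congr_fun this f

/-- The linear substitution `X ↦ h X` in the coordinate ring of the space of matrices. -/
noncomputable def substMat (A : Type*) [CommRing A] [Algebra ℂ A]
    (h : Matrix (Fin 2) (Fin 2) ℂ) :
    MvPolynomial (Fin 2 × Fin 6) A →ₐ[A] MvPolynomial (Fin 2 × Fin 6) A :=
  MvPolynomial.aeval fun kj =>
    ∑ l, MvPolynomial.C (algebraMap ℂ A (h kj.1 l)) * MvPolynomial.X (l, kj.2)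

lemma slAct_eq (A : Type u) [CommRing A] [Algebra ℂ A] (g : SL(2, ℂ)) :
    slAct A g = substMat A ((g⁻¹ : SL(2, ℂ)) : Matrix (Fin 2) (Fin 2) ℂ) := by
  refine MvPolynomial.algHom_ext fun kj => ?_
  simp only [slAct, substMat, MonoidHom.coe_mk, OneHom.coe_mk, MvPolynomial.aeval_X,
    Matrix.mul_apply, Matrix.map_apply, Matrix.mvPolynomialX_apply, MvPolynomial.algebraMap_apply]

lemma scaleAct_eq (A : Type u) [CommRing A] [Algebra ℂ A] (t : ℂˣ) :
    scaleAct A t = substMat A (((t⁻¹ : ℂˣ) : ℂ) • 1) := by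
  refine MvPolynomial.algHom_ext fun kj => ?_
  obtain ⟨k, j⟩ := kj
  simp only [scaleAct, substMat, MonoidHom.coe_mk, OneHom.coe_mk, MvPolynomial.aeval_X,
    MvPolynomial.algebraMap_apply, Matrix.smul_apply]
  rw [Finset.sum_eq_single k]
  · simp
  · intro b _ hb
    simp [Matrix.one_apply_ne hb.symm]
  · simp

lemma binAct_eq (g : SL(2, ℂ)) :
    binAct g = substBin ℂ ((g⁻¹ : SL(2, ℂ)) : Matrix (Fin 2) (Fin 2) ℂ) := by
  refine MvPolynomial.algHom_ext fun k => ?_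
  simp only [binAct, substBin, MonoidHom.coe_mk, OneHom.coe_mk, MvPolynomial.aeval_X,
    Matrix.mulVec, dotProduct, Matrix.map_apply, Algebra.algebraMap_self, RingHom.id_apply]

lemma map_substBin {B : Type*} [CommRing B] [Algebra ℂ B] (h : Matrix (Fin 2) (Fin 2) ℂ)
    (p : MvPolynomial (Fin 2) ℂ) :
    MvPolynomial.map (algebraMap ℂ B) (substBin ℂ h p) =
      substBin B h (MvPolynomial.map (algebraMap ℂ B) p) := by
  have : (MvPolynomial.map (algebraMap ℂ B)).comp (substBin ℂ h).toRingHom =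
      (substBin B h).toRingHom.comp (MvPolynomial.map (algebraMap ℂ B)) := by
    refine MvPolynomial.ringHom_ext (fun r => ?_) fun k => ?_
    · simp [substBin]
    · simp [substBin]
  exact DFunLike.congr_fun this p

lemma substMat_mul (A : Type*) [CommRing A] [Algebra ℂ A] (h k : Matrix (Fin 2) (Fin 2) ℂ)
    (f : MvPolynomial (Fin 2 × Fin 6) A) :
    substMat A k (substMat A h f) = substMat A (h * k) f := by
  have : (substMat A k).comp (substMat A h) = substMat A (h * k) := by
    refine MvPolynomial.algHom_ext fun kj => ?_
    simp only [substMat, AlgHom.comp_apply, MvPolynomial.aeval_X, map_sum, map_mul,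
      MvPolynomial.algHom_C, MvPolynomial.algebraMap_eq, Matrix.mul_apply]
    simp only [Fin.sum_univ_two]
    ring
  exact DFunLike.congr_fun this f

/-- The power `(a x + b y)^d`. -/
noncomputable def linPow (d : ℕ) (a b : ℂ) : MvPolynomial (Fin 2) ℂ :=
  (MvPolynomial.C a * MvPolynomial.X 0 + MvPolynomial.C b * MvPolynomial.X 1) ^ d

/-- The binary forms of degree `d` are spanned by the powers of linear forms. -/
lemma homogeneousSubmodule_le_span_linPow (d : ℕ) :
    MvPolynomial.homogeneousSubmodule (Fin 2) ℂ d ≤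
      Submodule.span ℂ {q | ∃ a b : ℂ, a ≠ 0 ∧ q = linPow d a b} := by
  set W := Submodule.span ℂ {q | ∃ a b : ℂ, a ≠ 0 ∧ q = linPow d a b}
  -- The power `(x + s y)^d` is a polynomial in `s` with values in `W`. Its coefficients are
  -- monomials times binomial coefficients, which are invertible in `ℂ`.
  have key : ∀ i < d + 1,
      (d.choose i : ℂ) • (MvPolynomial.X 1 ^ i * MvPolynomial.X 0 ^ (d - i) :
        MvPolynomial (Fin 2) ℂ) ∈ W := by
    intro i hi
    refine mem_of_forall_sum_pow_smul_mem W Set.infinite_univ (d + 1)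
      (fun i => (d.choose i : ℂ) • (MvPolynomial.X 1 ^ i * MvPolynomial.X 0 ^ (d - i) :
        MvPolynomial (Fin 2) ℂ)) (fun s _ => ?_) hi
    refine Submodule.subset_span ⟨1, s, one_ne_zero, ?_⟩
    rw [linPow, add_comm (MvPolynomial.C 1 * _), add_pow]
    refine Finset.sum_congr rfl fun j _ => ?_
    simp only [MvPolynomial.smul_eq_C_mul, map_pow, map_natCast, map_one]
    ring
  intro p hp
  rw [p.as_sum]
  refine Submodule.sum_mem _ fun m hm => ?_
  have hd : m 0 + m 1 = d := by
    have := hp (MvPolynomial.mem_support_iff.1 hm)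
    simpa [Finsupp.weight_apply, Finsupp.sum_fintype] using this
  have h1 := key (m 1) (by omega)
  have h2 := (Submodule.smul_mem_iff W
    (Nat.cast_ne_zero.2 (Nat.choose_pos (show m 1 ≤ d by omega)).ne')).1 h1
  have h3 : MvPolynomial.monomial m (MvPolynomial.coeff m p) = MvPolynomial.coeff m p •
      (MvPolynomial.X 1 ^ m 1 * MvPolynomial.X 0 ^ (d - m 1) : MvPolynomial (Fin 2) ℂ) := by
    rw [MvPolynomial.monomial_eq, Finsupp.prod_fintype _ _ (by simp), MvPolynomial.smul_eq_C_mul,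
      Fin.prod_univ_two, show d - m 1 = m 0 by omega]
    ring
  rw [h3]
  exact W.smul_mem _ h2

/-- The second row is free, so it can be chosen to give the determinant that equivariance requires.
-/
lemma linPow_eq_substBin (d : ℕ) (a b c e : ℂ) :
    linPow d a b = substBin ℂ !![a, b; c, e] (MvPolynomial.X 0 ^ d) := by
  simp [linPow, substBin]

/-! ### Matrices of rank one and the ideal of minors -/

/-- The pullback of functions on matrices along `(w, b) ↦ w bᵗ`. -/
noncomputable def seg (A : Type*) [CommRing A] {B : Type*} [CommRing B] [Algebra A B]
    (b : Fin 6 → B) : MvPolynomial (Fin 2 × Fin 6) A →ₐ[A] MvPolynomial (Fin 2) B :=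
  MvPolynomial.aeval fun kj => MvPolynomial.X kj.1 * MvPolynomial.C (b kj.2)

/-- The inclusion of the polynomial functions of the first row. -/
noncomputable def rowHom (A : Type*) [CommRing A] :
    MvPolynomial (Fin 6) A →ₐ[A] MvPolynomial (Fin 2 × Fin 6) A :=
  MvPolynomial.aeval fun j => MvPolynomial.X (0, j)

/-- The parametrisation of rank-one matrices is equivariant: `h (w bᵗ) = (h w) bᵗ`. -/
lemma seg_substMat {A B : Type*} [CommRing A] [Algebra ℂ A] [CommRing B] [Algebra ℂ B]
    [Algebra A B] [IsScalarTower ℂ A B] (b : Fin 6 → B) (h : Matrix (Fin 2) (Fin 2) ℂ)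
    (f : MvPolynomial (Fin 2 × Fin 6) A) :
    seg A b (substMat A h f) = substBin B h (seg A b f) := by
  have : (seg A b).comp (substMat A h) = ((substBin B h).restrictScalars A).comp (seg A b) := by
    refine MvPolynomial.algHom_ext fun kj => ?_
    simp only [seg, substMat, substBin, AlgHom.comp_apply, MvPolynomial.aeval_X, map_sum, map_mul,
      MvPolynomial.algHom_C, MvPolynomial.algebraMap_eq, AlgHom.restrictScalars_apply,
      Finset.sum_mul, MvPolynomial.algebraMap_apply, ← IsScalarTower.algebraMap_apply ℂ A B]
    simp only [Fin.sum_univ_two]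
    ring
  exact DFunLike.congr_fun this f

lemma seg_eq_map {A B C : Type*} [CommRing A] [CommRing B] [CommRing C] [Algebra A B]
    [Algebra A C] (q : B →ₐ[A] C) (b : Fin 6 → B) (f : MvPolynomial (Fin 2 × Fin 6) A) :
    seg A (fun j => q (b j)) f = MvPolynomial.map (q : B →+* C) (seg A b f) := by
  have : seg A (fun j => q (b j)) = (MvPolynomial.mapAlgHom q).comp (seg A b) := by
    refine MvPolynomial.algHom_ext fun kj => ?_
    simp [seg]
  exact DFunLike.congr_fun this f

/-- The ideal of all `2 × 2` minors. -/
noncomputable def minorIdeal (A : Type u) [CommRing A] : Ideal (CoordRing A) :=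
  Ideal.span {f | ∃ i j : Fin 6, f = minor A i j}

lemma minor_eq (A : Type u) [CommRing A] (i j : Fin 6) :
    minor A i j = MvPolynomial.X (0, i) * MvPolynomial.X (1, j) -
      MvPolynomial.X (0, j) * MvPolynomial.X (1, i) := by
  simp [minor, Matrix.det_fin_two]

lemma minor_mem (A : Type u) [CommRing A] (i j : Fin 6) : minor A i j ∈ minorIdeal A :=
  Ideal.subset_span ⟨i, j, rfl⟩

lemma seg_minor {A : Type u} {B : Type*} [CommRing A] [CommRing B] [Algebra A B] (b : Fin 6 → B)
    (i j : Fin 6) : seg A b (minor A i j) = 0 := by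
  rw [minor_eq]
  simp only [seg, map_sub, map_mul, MvPolynomial.aeval_X]
  ring

/-- The exchange move: two factors of a monomial may trade their column indices. In equal rows
nothing changes; in different rows the difference is a minor. -/
lemma X_mul_X_sub_mem_minorIdeal (A : Type u) [CommRing A] (k k' : Fin 2) (i j : Fin 6) :
    (MvPolynomial.X (k, i) * MvPolynomial.X (k', j) -
      MvPolynomial.X (k, j) * MvPolynomial.X (k', i) : CoordRing A) ∈ minorIdeal A := by
  have h01 := minor_mem A i j
  have h10 := minor_mem A j i
  rw [minor_eq] at h01 h10
  fin_cases k <;> fin_cases k'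
  · convert (minorIdeal A).zero_mem using 1
    simp only [Fin.zero_eta]
    ring
  · exact h01
  · convert h10 using 1
    simp only [Fin.zero_eta, Fin.mk_one]
    ring
  · convert (minorIdeal A).zero_mem using 1
    simp only [Fin.mk_one]
    ring

lemma exists_eq_single_add {ι : Type*} [DecidableEq ι] (m : ι →₀ ℕ) (i : ι) (h : m i ≠ 0) :
    ∃ m', m = Finsupp.single i 1 + m' :=
  ⟨m - Finsupp.single i 1, (add_tsub_cancel_of_le (by
    rw [Finsupp.single_le_iff]; omega)).symm⟩

lemma exists_apply_ne_zero_of_mapDomain {ι κ : Type*} [DecidableEq κ] (f : ι → κ) (m : ι →₀ ℕ)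
    (k : κ) (h : Finsupp.mapDomain f m k ≠ 0) : ∃ i, f i = k ∧ m i ≠ 0 := by
  have := Finsupp.mapDomain_support (Finsupp.mem_support_iff.2 h)
  simpa [and_comm] using this

/-- Two monomials with the same row sums and column sums agree modulo the minors. -/
lemma mk_monomial_eq_of_mapDomain_eq (A : Type u) [CommRing A] (n : ℕ) :
    ∀ m m' : Fin 2 × Fin 6 →₀ ℕ, m.degree = n →
      m.mapDomain Prod.fst = m'.mapDomain Prod.fst →
      m.mapDomain Prod.snd = m'.mapDomain Prod.snd →
      Ideal.Quotient.mk (minorIdeal A) (MvPolynomial.monomial m 1) =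
        Ideal.Quotient.mk (minorIdeal A) (MvPolynomial.monomial m' 1) := by
  have hdeg : ∀ {κ : Type} (f : Fin 2 × Fin 6 → κ) (m : Fin 2 × Fin 6 →₀ ℕ),
      (m.mapDomain f).degree = m.degree := by
    intro κ f m
    induction m using Finsupp.induction_linear with
    | zero => simp
    | add f g hf hg => rw [Finsupp.mapDomain_add, map_add, map_add, hf, hg]
    | single a b => rw [Finsupp.mapDomain_single, Finsupp.degree_single, Finsupp.degree_single]
  induction n with
  | zero =>
    intro m m' hm h1 _
    have h0 : m' = 0 := by
      rw [← Finsupp.degree_eq_zero_iff, ← hdeg Prod.fst, ← h1, hdeg, hm]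
    rw [(Finsupp.degree_eq_zero_iff m).1 hm, h0]
  | succ n ih =>
    intro m m' hm h1 h2
    obtain ⟨⟨k, j⟩, hkj⟩ : ∃ p, m p ≠ 0 := by
      by_contra! h
      have : m = 0 := Finsupp.ext h
      simp [this] at hm
    obtain ⟨m₁, rfl⟩ := exists_eq_single_add m _ hkj
    -- The variable `(k, j)` is brought into `m'`. If it is absent, equality of row and column sums
    -- provides variables `(k, j')` and `(k', j)` in `m'`, and the exchange move replaces them by
    -- `(k, j)` and `(k', j')`.
    obtain ⟨m₂, h1', h2', h3⟩ : ∃ m₂ : Fin 2 × Fin 6 →₀ ℕ,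
        m'.mapDomain Prod.fst = (Finsupp.single (k, j) 1 + m₂).mapDomain Prod.fst ∧
        m'.mapDomain Prod.snd = (Finsupp.single (k, j) 1 + m₂).mapDomain Prod.snd ∧
        Ideal.Quotient.mk (minorIdeal A) (MvPolynomial.monomial m' 1) =
        Ideal.Quotient.mk (minorIdeal A) (MvPolynomial.monomial (Finsupp.single (k, j) 1 + m₂) 1) := by
      by_cases hc : m' (k, j) = 0
      · obtain ⟨⟨k₁, j'⟩, hk, hj'⟩ := exists_apply_ne_zero_of_mapDomain Prod.fst m' k (by
          rw [← h1, Finsupp.mapDomain_add, Finsupp.mapDomain_single]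
          simp)
        obtain ⟨⟨k', j₁⟩, hj, hk'⟩ := exists_apply_ne_zero_of_mapDomain Prod.snd m' j (by
          rw [← h2, Finsupp.mapDomain_add, Finsupp.mapDomain_single]
          simp)
        dsimp only at hk hj
        subst hk hj
        have hne : (k₁, j') ≠ (k', j₁) := by
          rintro h
          simp only [Prod.mk.injEq] at h
          rw [h.2] at hj'
          exact hj' hc
        obtain ⟨m₃, rfl⟩ := exists_eq_single_add m' _ hj'
        obtain ⟨m₄, rfl⟩ := exists_eq_single_add m₃ (k', j₁) (by
          rwa [Finsupp.add_apply, Finsupp.single_eq_of_ne hne.symm, zero_add] at hk')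
        refine ⟨Finsupp.single (k', j') 1 + m₄, ?_, ?_, ?_⟩
        · simp only [Finsupp.mapDomain_add, Finsupp.mapDomain_single]
        · simp only [Finsupp.mapDomain_add, Finsupp.mapDomain_single]
          exact add_left_comm _ _ _
        · rw [Ideal.Quotient.eq]
          have := (minorIdeal A).mul_mem_right (MvPolynomial.monomial m₄ 1)
            (X_mul_X_sub_mem_minorIdeal A k₁ k' j' j₁)
          rw [sub_mul] at this
          simpa only [MvPolynomial.X, MvPolynomial.monomial_mul, mul_one, add_assoc] using this
      · obtain ⟨m₂, rfl⟩ := exists_eq_single_add m' _ hc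
        exact ⟨m₂, rfl, rfl, rfl⟩
    rw [h3]
    rw [h1', Finsupp.mapDomain_add, Finsupp.mapDomain_add, add_right_inj] at h1
    rw [h2', Finsupp.mapDomain_add, Finsupp.mapDomain_add, add_right_inj] at h2
    have := ih m₁ m₂ (by simpa [add_comm 1] using hm) h1 h2
    have hs : ∀ m : Fin 2 × Fin 6 →₀ ℕ, (MvPolynomial.monomial (Finsupp.single (k, j) 1 + m) 1 :
        CoordRing A) = MvPolynomial.X (k, j) * MvPolynomial.monomial m 1 := by
      intro m
      rw [MvPolynomial.X, MvPolynomial.monomial_mul, one_mul]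
    rw [hs, hs, map_mul, map_mul, this]

/-- Thus `seg` identifies monomials precisely when their row and column sums agree, which is the
situation of `mk_monomial_eq_of_mapDomain_eq`. -/
lemma seg_monomial (A : Type*) [CommRing A] (m : Fin 2 × Fin 6 →₀ ℕ) (a : A) :
    seg A (MvPolynomial.X : Fin 6 → MvPolynomial (Fin 6) A) (MvPolynomial.monomial m a) =
      MvPolynomial.monomial (m.mapDomain Prod.fst)
        (MvPolynomial.monomial (m.mapDomain Prod.snd) a) := by
  induction m using Finsupp.induction_linear generalizing a with
  | zero => simp [seg, ← MvPolynomial.C_apply]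
  | add f g hf hg =>
    rw [← mul_one a, ← MvPolynomial.monomial_mul, map_mul, hf, hg, Finsupp.mapDomain_add,
      Finsupp.mapDomain_add, MvPolynomial.monomial_mul, MvPolynomial.monomial_mul]
  | single p n =>
    rw [Finsupp.mapDomain_single, Finsupp.mapDomain_single, seg, MvPolynomial.aeval_monomial,
      Finsupp.prod_single_index (by exact pow_zero _), mul_pow, MvPolynomial.X_pow_eq_monomial, ← map_pow,
      MvPolynomial.X_pow_eq_monomial, mul_comm (MvPolynomial.monomial _ _),
      MvPolynomial.algebraMap_apply, ← mul_assoc, ← map_mul, MvPolynomial.C_mul_monomial, mul_one,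
      MvPolynomial.algebraMap_eq, MvPolynomial.C_mul_monomial, mul_one]

lemma coeff_seg (A : Type*) [CommRing A] (f : MvPolynomial (Fin 2 × Fin 6) A) (m : Fin 2 →₀ ℕ) :
    MvPolynomial.coeff m (seg A (MvPolynomial.X : Fin 6 → MvPolynomial (Fin 6) A) f) =
      ∑ p ∈ f.support with p.mapDomain Prod.fst = m,
        MvPolynomial.monomial (p.mapDomain Prod.snd) (MvPolynomial.coeff p f) := by
  conv_lhs => rw [f.as_sum]
  rw [map_sum, MvPolynomial.coeff_sum, Finset.sum_filter]
  refine Finset.sum_congr rfl fun p _ => ?_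
  rw [seg_monomial, MvPolynomial.coeff_monomial]

/-- Row sums and column sums of a monomial both add up to its degree. This pairs binary forms of
degree `d` with forms of degree `d` in six variables. -/
lemma isHomogeneous_coeff_seg (A : Type*) [CommRing A] (f : MvPolynomial (Fin 2 × Fin 6) A)
    (m : Fin 2 →₀ ℕ) :
    (MvPolynomial.coeff m (seg A (MvPolynomial.X : Fin 6 → MvPolynomial (Fin 6) A) f)).IsHomogeneous
      m.degree := by
  have hdeg : ∀ {κ : Type} (f : Fin 2 × Fin 6 → κ) (m : Fin 2 × Fin 6 →₀ ℕ),
      (m.mapDomain f).degree = m.degree := by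
    intro κ f m
    induction m using Finsupp.induction_linear with
    | zero => simp
    | add f g hf hg => rw [Finsupp.mapDomain_add, map_add, map_add, hf, hg]
    | single a b => rw [Finsupp.mapDomain_single, Finsupp.degree_single, Finsupp.degree_single]
  rw [coeff_seg]
  refine MvPolynomial.IsHomogeneous.sum _ _ _ fun p hp => ?_
  refine MvPolynomial.isHomogeneous_monomial _ ?_
  rw [hdeg, ← (Finset.mem_filter.1 hp).2, hdeg]

/-- The functions vanishing on the matrices of rank at most one are generated by the minors. -/
lemma mem_minorIdeal_of_seg_eq_zero {A : Type u} [CommRing A] {f : CoordRing A}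
    (h : seg A (MvPolynomial.X : Fin 6 → MvPolynomial (Fin 6) A) f = 0) : f ∈ minorIdeal A := by
  classical
  rw [← Ideal.Quotient.eq_zero_iff_mem]
  let rc : (Fin 2 × Fin 6 →₀ ℕ) → (Fin 2 →₀ ℕ) × (Fin 6 →₀ ℕ) :=
    fun p => (p.mapDomain Prod.fst, p.mapDomain Prod.snd)
  have hmon : ∀ (p : Fin 2 × Fin 6 →₀ ℕ) (a : A), Ideal.Quotient.mk (minorIdeal A)
      (MvPolynomial.monomial p a) =
        a • Ideal.Quotient.mk (minorIdeal A) (MvPolynomial.monomial p 1) := by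
    intro p a
    rw [← Ideal.Quotient.mkₐ_eq_mk A, ← map_smul, MvPolynomial.smul_monomial, smul_eq_mul, mul_one]
  -- Monomials are grouped by row and column sums. Within a group they agree modulo the minors, and
  -- the sum of their coefficients in `f` is a coefficient of `seg A X f`, hence zero.
  rw [f.as_sum, map_sum,
    ← Finset.sum_fiberwise_of_maps_to (g := rc) (fun p hp => Finset.mem_image_of_mem rc hp)]
  refine Finset.sum_eq_zero fun q hq => ?_
  obtain ⟨p₀, -, rfl⟩ := Finset.mem_image.1 hq
  have h1 : ∀ p ∈ f.support.filter (fun p => rc p = rc p₀), Ideal.Quotient.mk (minorIdeal A)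
      (MvPolynomial.monomial p (MvPolynomial.coeff p f)) = MvPolynomial.coeff p f •
        Ideal.Quotient.mk (minorIdeal A) (MvPolynomial.monomial p₀ 1) := by
    intro p hp
    have hp := (Finset.mem_filter.1 hp).2
    rw [hmon, mk_monomial_eq_of_mapDomain_eq A _ p p₀ rfl (congrArg Prod.fst hp)
      (congrArg Prod.snd hp)]
  rw [Finset.sum_congr rfl h1, ← Finset.sum_smul]
  have h2 := congrArg (fun g => MvPolynomial.coeff (rc p₀).2 (MvPolynomial.coeff (rc p₀).1 g)) h
  simp only [coeff_seg, MvPolynomial.coeff_sum, MvPolynomial.coeff_monomial,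
    MvPolynomial.coeff_zero] at h2
  rw [← Finset.sum_filter, Finset.filter_filter] at h2
  have h3 : f.support.filter (fun p => rc p = rc p₀) = f.support.filter (fun p =>
      p.mapDomain Prod.fst = (rc p₀).1 ∧ p.mapDomain Prod.snd = (rc p₀).2) :=
    Finset.filter_congr fun p _ => Prod.ext_iff
  rw [h3, h2, zero_smul]

lemma seg_rowHom {A B : Type*} [CommRing A] [CommRing B] [Algebra A B] (b : Fin 6 → B) {d : ℕ}
    {c : MvPolynomial (Fin 6) A} (hc : c.IsHomogeneous d) :
    seg A b (rowHom A c) = MvPolynomial.X 0 ^ d * MvPolynomial.C (MvPolynomial.aeval b c) := by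
  rw [c.as_sum]
  simp only [map_sum, Finset.mul_sum]
  refine Finset.sum_congr rfl fun n hn => ?_
  have hd : n.degree = d := by
    have := hc (MvPolynomial.mem_support_iff.1 hn)
    rwa [Finsupp.degree_eq_weight_one]
  rw [rowHom, MvPolynomial.aeval_monomial, map_mul, Finsupp.prod_fintype _ _ (by simp), map_prod,
    MvPolynomial.aeval_monomial, Finsupp.prod_fintype _ _ (by simp)]
  simp only [map_pow, seg, MvPolynomial.aeval_X, mul_pow, Finset.prod_mul_distrib, map_mul,
    map_prod, Finset.prod_pow_eq_pow_sum]
  rw [← hd, Finsupp.degree_eq_sum, MvPolynomial.algebraMap_eq, MvPolynomial.algHom_C,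
    MvPolynomial.algebraMap_apply]
  ring

/-- The substitution on the right has determinant zero, so the stability of an ideal under it needs
the limit argument of `IsConical.substMat_limit_mem`. -/
lemma rowHom_evalAt_seg {A : Type*} [CommRing A] [Algebra ℂ A] (a : Fin 2 → ℂ)
    (f : MvPolynomial (Fin 2 × Fin 6) A) :
    rowHom A (evalAt a (seg A (MvPolynomial.X : Fin 6 → MvPolynomial (Fin 6) A) f)) =
      substMat A !![a 0, 0; a 1, 0] f := by
  have : (rowHom A).comp (((evalAt a).restrictScalars A).comp
      (seg A (MvPolynomial.X : Fin 6 → MvPolynomial (Fin 6) A))) =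
      substMat A !![a 0, 0; a 1, 0] := by
    refine MvPolynomial.algHom_ext fun kj => ?_
    obtain ⟨k, j⟩ := kj
    fin_cases k <;> simp [rowHom, evalAt, seg, substMat, MvPolynomial.algebraMap_apply]
  exact DFunLike.congr_fun this f

/-! ### Conical stable ideals containing the minors -/

/-- An ideal which is stable under `SL₂` and `ℂ*`. -/
structure IsConical {A : Type u} [CommRing A] [Algebra ℂ A] (I : Ideal (CoordRing A)) : Prop where
  slStable : SlStable I
  map_scaleAct : ∀ t : ℂˣ, I.map (scaleAct A t) = I

/-- Since `det h` has a square root `t`, the matrix `h` is `t` times an element of `SL₂(ℂ)`. -/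
lemma IsConical.substMat_mem {A : Type u} [CommRing A] [Algebra ℂ A] {I : Ideal (CoordRing A)}
    (hI : IsConical I) {h : Matrix (Fin 2) (Fin 2) ℂ} (hh : h.det ≠ 0) {f : CoordRing A}
    (hf : f ∈ I) : substMat A h f ∈ I := by
  obtain ⟨t, ht⟩ := IsAlgClosed.exists_pow_nat_eq h.det (n := 2) (by norm_num)
  have ht0 : t ≠ 0 := by
    rintro rfl
    exact hh (by simpa using ht.symm)
  let g : SL(2, ℂ) := ⟨t⁻¹ • h, by
    rw [Matrix.det_smul, Fintype.card_fin, ← ht, inv_pow, inv_mul_cancel₀ (pow_ne_zero 2 ht0)]⟩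
  have h1 : slAct A g⁻¹ f ∈ I := hI.slStable g⁻¹ hf
  have h2 := Ideal.mem_map_of_mem (scaleAct A (Units.mk0 t ht0)⁻¹) h1
  have hg : (g⁻¹)⁻¹ = g := inv_inv g
  rw [hI.map_scaleAct, slAct_eq, scaleAct_eq, substMat_mul, hg, inv_inv] at h2
  have hgh : (g : Matrix (Fin 2) (Fin 2) ℂ) * (((Units.mk0 t ht0 : ℂˣ) : ℂ) • 1) = h := by
    simp [g, smul_smul, ht0]
  rwa [hgh] at h2

/-- The singular matrix is the limit at `s = 0` of the matrices `!![a 0, 0; a 1, s]`, which are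
invertible for `s ≠ 0`. The transform of `f` is a polynomial in `s` (here `D f`) with values in `I`
for `s ≠ 0`, so its constant coefficient lies in `I`. -/
lemma IsConical.substMat_limit_mem {A : Type u} [CommRing A] [Algebra ℂ A]
    {I : Ideal (CoordRing A)} (hI : IsConical I) {a : Fin 2 → ℂ} (ha : a 0 ≠ 0) {f : CoordRing A}
    (hf : f ∈ I) : substMat A !![a 0, 0; a 1, 0] f ∈ I := by
  let D : CoordRing A →ₐ[A] Polynomial (CoordRing A) := MvPolynomial.aeval fun kj =>
    Polynomial.C (MvPolynomial.C (algebraMap ℂ A (a kj.1)) * MvPolynomial.X (0, kj.2)) +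
      (if kj.1 = 1 then Polynomial.X * Polynomial.C (MvPolynomial.X (1, kj.2)) else 0)
  have hD : ∀ s : ℂ, Polynomial.aeval (algebraMap ℂ (CoordRing A) s) (D f) =
      substMat A !![a 0, 0; a 1, s] f := by
    intro s
    have : ((Polynomial.aeval (algebraMap ℂ (CoordRing A) s)).restrictScalars A).comp D =
        substMat A !![a 0, 0; a 1, s] := by
      refine MvPolynomial.algHom_ext fun kj => ?_
      obtain ⟨k, j⟩ := kj
      fin_cases k
      · simp [D, substMat, MvPolynomial.algebraMap_apply]
      · simp [D, substMat, MvPolynomial.algebraMap_apply]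
        exact mul_comm _ _
    exact DFunLike.congr_fun this f
  have h0 := hD 0
  rw [map_zero, ← Polynomial.coeff_zero_eq_aeval_zero] at h0
  rw [← h0]
  refine mem_of_forall_sum_pow_smul_mem (I.restrictScalars ℂ) infinite_compl_zero
    ((D f).natDegree + 1) (fun i => (D f).coeff i) (fun s hs => ?_) (Nat.succ_pos _)
  have h1 : substMat A !![a 0, 0; a 1, s] f ∈ I :=
    hI.substMat_mem (by simpa [Matrix.det_fin_two] using ⟨ha, hs⟩) hf
  rw [← hD, Polynomial.aeval_eq_sum_range] at h1
  rw [Submodule.restrictScalars_mem]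
  have h2 : ∀ i, s ^ i • (D f).coeff i =
      (D f).coeff i • algebraMap ℂ (CoordRing A) s ^ i := fun i => by
    rw [Algebra.smul_def, smul_eq_mul, map_pow, mul_comm]
  simpa only [h2] using h1

/-- The product of a binary form and a form of the same degree comes from a function on matrices,
which lies in any stable subspace containing the associated function of the first row. -/
lemma exists_seg_eq {A B : Type*} [CommRing A] [Algebra ℂ A] [CommRing B] [Algebra ℂ B]
    [Algebra A B] [IsScalarTower ℂ A B] (b : Fin 6 → B)
    (W : Submodule ℂ (MvPolynomial (Fin 2 × Fin 6) A))
    (hW : ∀ h : Matrix (Fin 2) (Fin 2) ℂ, h.det ≠ 0 → ∀ f ∈ W, substMat A h f ∈ W)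
    {d : ℕ} {c : MvPolynomial (Fin 6) A} (hc : c.IsHomogeneous d) (hcW : rowHom A c ∈ W)
    {p : MvPolynomial (Fin 2) ℂ} (hp : p.IsHomogeneous d) :
    ∃ f ∈ W, seg A b f =
      MvPolynomial.map (algebraMap ℂ B) p * MvPolynomial.C (MvPolynomial.aeval b c) := by
  have hp' := homogeneousSubmodule_le_span_linPow d hp
  clear hp
  induction hp' using Submodule.span_induction with
  | mem q hq =>
    obtain ⟨a, e, ha, rfl⟩ := hq
    -- The function `rowHom A c` pulls back to `x^d` times `c(b)`, and an invertible substitution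
    -- carries `x^d` to `(a x + e y)^d`.
    refine ⟨substMat A !![a, e; 0, 1] (rowHom A c),
      hW _ (by simpa [Matrix.det_fin_two] using ha) _ hcW, ?_⟩
    rw [seg_substMat, seg_rowHom b hc, map_mul, linPow_eq_substBin d a e 0 1, map_substBin,
      map_pow (MvPolynomial.map _), MvPolynomial.map_X, MvPolynomial.algHom_C,
      MvPolynomial.algebraMap_eq]
  | zero => exact ⟨0, W.zero_mem, by simp⟩
  | add q r _ _ hq hr =>
    obtain ⟨f, hf, hf'⟩ := hq
    obtain ⟨g, hg, hg'⟩ := hr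
    exact ⟨f + g, W.add_mem hf hg, by rw [map_add, map_add, hf', hg', add_mul]⟩
  | smul z q _ hq =>
    obtain ⟨f, hf, hf'⟩ := hq
    refine ⟨z • f, W.smul_mem z hf, ?_⟩
    rw [← algebraMap_smul A z f, map_smul, hf', MvPolynomial.smul_eq_C_mul, map_mul,
      MvPolynomial.map_C, mul_assoc, ← algebraMap_smul B (algebraMap ℂ A z),
      MvPolynomial.smul_eq_C_mul, ← IsScalarTower.algebraMap_apply]

/-- The ideal of the polynomials in the first row which lie in `I`. -/
noncomputable abbrev rowIdeal {A : Type u} [CommRing A] (I : Ideal (CoordRing A)) :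
    Ideal (MvPolynomial (Fin 6) A) :=
  I.comap (rowHom A)

lemma evalAt_map {B C : Type*} [CommRing B] [CommRing C] [Algebra ℂ B] [Algebra ℂ C]
    (q : B →ₐ[ℂ] C) (a : Fin 2 → ℂ) (f : MvPolynomial (Fin 2) B) :
    evalAt a (MvPolynomial.map (q : B →+* C) f) = q (evalAt a f) := by
  have : ((evalAt a).toRingHom.comp (MvPolynomial.map (q : B →+* C)) : _ →+* C) =
      (q : B →+* C).comp (evalAt a).toRingHom := by
    refine MvPolynomial.ringHom_ext (fun r => ?_) fun k => ?_
    · simp [evalAt]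
    · simp [evalAt]
  exact DFunLike.congr_fun this f

/-- The generic point of the subscheme of `A⁶` cut out by `N`. -/
noncomputable abbrev genPt {A : Type u} [CommRing A] (N : Ideal (MvPolynomial (Fin 6) A)) :
    Fin 6 → MvPolynomial (Fin 6) A ⧸ N :=
  fun j => Ideal.Quotient.mkₐ A N (MvPolynomial.X j)

lemma aeval_genPt {A : Type u} [CommRing A] (N : Ideal (MvPolynomial (Fin 6) A))
    (c : MvPolynomial (Fin 6) A) :
    MvPolynomial.aeval (genPt N) c = Ideal.Quotient.mkₐ A N c := by
  have : MvPolynomial.aeval (genPt N) = Ideal.Quotient.mkₐ A N :=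
    MvPolynomial.algHom_ext fun j => by rw [MvPolynomial.aeval_X]
  rw [this]

lemma seg_genPt_eq_zero_iff {A : Type u} [CommRing A] (N : Ideal (MvPolynomial (Fin 6) A))
    (f : CoordRing A) : seg A (genPt N) f = 0 ↔
      ∀ m, MvPolynomial.coeff m (seg A (MvPolynomial.X : Fin 6 → MvPolynomial (Fin 6) A) f) ∈ N := by
  rw [seg_eq_map, MvPolynomial.ext_iff]
  refine forall_congr' fun m => ?_
  rw [MvPolynomial.coeff_map, MvPolynomial.coeff_zero, ← Ideal.Quotient.eq_zero_iff_mem]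
  rfl

/-- A conical stable ideal containing the minors is determined by the polynomials in the first row
which it contains. -/
lemma IsConical.mem_iff {A : Type u} [CommRing A] [Algebra ℂ A] {I : Ideal (CoordRing A)}
    (hI : IsConical I) (hm : minorIdeal A ≤ I) (f : CoordRing A) :
    f ∈ I ↔ seg A (genPt (rowIdeal I)) f = 0 := by
  constructor
  · intro hf
    -- For fixed `w = a` the pullback of `f` is a polynomial in the first row, namely the transform
    -- of `f` under a limit substitution.
    refine eq_zero_of_evalAt_eq_zero fun a ha => ?_
    rw [seg_eq_map]
    have := evalAt_map ((Ideal.Quotient.mkₐ A (rowIdeal I)).restrictScalars ℂ) a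
      (seg A (MvPolynomial.X : Fin 6 → MvPolynomial (Fin 6) A) f)
    refine this.trans ?_
    rw [AlgHom.restrictScalars_apply, Ideal.Quotient.mkₐ_eq_mk, Ideal.Quotient.eq_zero_iff_mem,
      Ideal.mem_comap, rowHom_evalAt_seg]
    exact hI.substMat_limit_mem ha hf
  · intro hf
    rw [seg_genPt_eq_zero_iff] at hf
    -- Each coefficient of `seg A X f` is a form in `N`, so each of its terms lifts to `I`. The
    -- resulting `f'` differs from `f` by an element of the ideal of minors.
    obtain ⟨f', hf', h⟩ : ∃ f' ∈ I, seg A (MvPolynomial.X : Fin 6 → MvPolynomial (Fin 6) A) f' =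
        seg A MvPolynomial.X f := by
      rw [(seg A (MvPolynomial.X : Fin 6 → MvPolynomial (Fin 6) A) f).as_sum]
      have : ∀ m : Fin 2 →₀ ℕ, ∃ f' ∈ I, seg A (MvPolynomial.X : Fin 6 → MvPolynomial (Fin 6) A) f' =
          MvPolynomial.monomial m (MvPolynomial.coeff m (seg A MvPolynomial.X f)) := by
        intro m
        obtain ⟨f', hf', h⟩ := exists_seg_eq (MvPolynomial.X : Fin 6 → MvPolynomial (Fin 6) A)
          (I.restrictScalars ℂ) (fun h hh f hf => hI.substMat_mem hh hf)
          (isHomogeneous_coeff_seg A f m) (hf m)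
          (MvPolynomial.isHomogeneous_monomial (1 : ℂ) (rfl : m.degree = m.degree))
        refine ⟨f', hf', h.trans ?_⟩
        rw [MvPolynomial.map_monomial, map_one, MvPolynomial.aeval_X_left_apply, mul_comm,
          MvPolynomial.C_mul_monomial, mul_one]
      choose F hF hF' using this
      exact ⟨_, I.sum_mem fun m _ => hF m, by rw [map_sum]; exact Finset.sum_congr rfl fun m _ => hF' m⟩
    have h1 : f' - f ∈ I := hm (mem_minorIdeal_of_seg_eq_zero (by rw [map_sub, h, sub_self]))
    simpa using I.sub_mem hf' h1

/-! ### The modules of covariants -/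

/-- An equivariant map from binary forms to polynomials in two variables over a `ℂ`-algebra is the
multiplication by a constant. -/
lemma exists_eq_map_mul_C {B : Type*} [CommRing B] [Algebra ℂ B] {d : ℕ}
    (φ : BinForm d →ₗ[ℂ] MvPolynomial (Fin 2) B)
    (hφ : ∀ (g : SL(2, ℂ)) (p : BinForm d), φ (binRep d g p) =
      substBin B ((g⁻¹ : SL(2, ℂ)) : Matrix (Fin 2) (Fin 2) ℂ) (φ p)) :
    ∃ β : B, ∀ p : BinForm d, φ p =
      MvPolynomial.map (algebraMap ℂ B) p * MvPolynomial.C β := by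
  obtain ⟨ψ, hψ⟩ := LinearMap.exists_extend φ
  have hψ' : ∀ p (hp : p ∈ MvPolynomial.homogeneousSubmodule (Fin 2) ℂ d), ψ p = φ ⟨p, hp⟩ :=
    fun p hp => DFunLike.congr_fun hψ ⟨p, hp⟩
  have hX : (MvPolynomial.X 0 ^ d : MvPolynomial (Fin 2) ℂ) ∈
      MvPolynomial.homogeneousSubmodule (Fin 2) ℂ d := MvPolynomial.isHomogeneous_X_pow 0 d
  have hsub : ∀ h : Matrix (Fin 2) (Fin 2) ℂ, h.det = 1 →
      ψ (substBin ℂ h (MvPolynomial.X 0 ^ d)) = substBin B h (ψ (MvPolynomial.X 0 ^ d)) := by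
    intro h hh
    obtain ⟨g, rfl⟩ : ∃ g : SL(2, ℂ), (g : Matrix (Fin 2) (Fin 2) ℂ) = h := ⟨⟨h, hh⟩, rfl⟩
    have hg : (g⁻¹)⁻¹ = g := inv_inv g
    have := hφ g⁻¹ ⟨_, hX⟩
    rw [hg] at this
    rw [hψ' _ hX]
    refine Eq.trans ?_ this
    have h2 : substBin ℂ g (MvPolynomial.X 0 ^ d) ∈
        MvPolynomial.homogeneousSubmodule (Fin 2) ℂ d := by
      have h3 := binAct_mem d g⁻¹ _ hX
      rw [AlgHom.toLinearMap_apply, binAct_eq, hg] at h3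
      exact h3
    have h4 : (⟨_, h2⟩ : BinForm d) = binRep d g⁻¹ ⟨_, hX⟩ := by
      refine Subtype.ext ?_
      change _ = binAct g⁻¹ (MvPolynomial.X 0 ^ d)
      rw [binAct_eq, hg]
    rw [hψ' _ h2, h4]
  set y := ψ (MvPolynomial.X 0 ^ d)
  -- The substitution by `!![a 0, 0; a 1, (a 0)⁻¹]` multiplies `x^d` by `(a 0)^d` and moves the
  -- point `(1, 0)` to `a`. Equivariance therefore determines the value of `y` at `a` from its value
  -- at `(1, 0)`.
  have hy : y = MvPolynomial.X 0 ^ d * MvPolynomial.C (evalAt ![1, 0] y) := by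
    rw [← sub_eq_zero]
    refine eq_zero_of_evalAt_eq_zero fun a ha => ?_
    have h1 := hsub !![a 0, 0; a 1, (a 0)⁻¹] (by simp [Matrix.det_fin_two, ha])
    have h2 : substBin ℂ !![a 0, 0; a 1, (a 0)⁻¹] (MvPolynomial.X 0 ^ d) =
        (a 0 ^ d) • MvPolynomial.X 0 ^ d := by
      simp [substBin, mul_pow, MvPolynomial.smul_eq_C_mul]
    rw [h2, map_smul] at h1
    have h3 := congrArg (evalAt ![1, 0]) h1
    rw [evalAt_substBin] at h3
    have h4 : !![a 0, 0; a 1, (a 0)⁻¹] *ᵥ ![1, 0] = a := by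
      ext k
      fin_cases k <;> simp [Matrix.mulVec, dotProduct]
    rw [h4] at h3
    rw [map_sub, ← h3, map_mul, ← algebraMap_smul B (a 0 ^ d) (ψ _), map_smul]
    simp [evalAt, y]
  refine ⟨evalAt ![1, 0] y, fun p => ?_⟩
  rw [← hψ' p p.2]
  let χ : MvPolynomial (Fin 2) ℂ →ₗ[ℂ] MvPolynomial (Fin 2) B :=
    (LinearMap.mulRight ℂ (MvPolynomial.C (evalAt ![1, 0] y))).comp
      (MvPolynomial.mapAlgHom (Algebra.ofId ℂ B)).toLinearMap
  -- Both maps agree on `x^d`, hence on its `SL₂`-translates, which span the binary forms.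
  have : Set.EqOn ψ χ (Submodule.span ℂ {q | ∃ a b : ℂ, a ≠ 0 ∧ q = linPow d a b}) := by
    refine LinearMap.eqOn_span ?_
    rintro _ ⟨a, b, ha, rfl⟩
    rw [linPow_eq_substBin d a b 0 a⁻¹, hsub _ (by simp [Matrix.det_fin_two, ha])]
    conv_lhs => rw [hy]
    change _ = MvPolynomial.map (algebraMap ℂ B) _ * _
    rw [map_substBin]
    simp [substBin]
  exact this (homogeneousSubmodule_le_span_linPow d p.2)

/-- The component of degree `d` of the quotient of `A[z₁, …, z₆]` by `N`. -/
abbrev gradedQuot {A : Type u} [CommRing A] (N : Ideal (MvPolynomial (Fin 6) A)) (d : ℕ) :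
    Type u :=
  MvPolynomial.homogeneousSubmodule (Fin 6) A d ⧸
    (N.restrictScalars A).comap (MvPolynomial.homogeneousSubmodule (Fin 6) A d).subtype

/-- The module of covariants of type `V_d` is the component of degree `d` of the quotient by the
highest weight vectors. -/
lemma IsConical.nonempty_covariants_equiv {A : Type u} [CommRing A] [Algebra ℂ A]
    {I : Ideal (CoordRing A)} (hI : IsConical I) (hm : minorIdeal A ≤ I) (d : ℕ) :
    Nonempty (covariants I hI.slStable d ≃ₗ[A] gradedQuot (rowIdeal I) d) := by
  set N := rowIdeal I
  let B := MvPolynomial (Fin 6) A ⧸ N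
  -- This is an equivariant embedding of `A[X]/I` into `B[x, y]`, where covariants are
  -- multiplications by constants of `B`.
  let sq : (CoordRing A ⧸ I) →ₐ[A] MvPolynomial (Fin 2) B :=
    Ideal.Quotient.liftₐ I (seg A (genPt N)) fun f hf => (hI.mem_iff hm f).1 hf
  have sq_mk : ∀ f, sq (Ideal.Quotient.mkₐ A I f) = seg A (genPt N) f := fun f => rfl
  have sq_inj : Function.Injective sq := by
    rw [injective_iff_map_eq_zero]
    intro x hx
    obtain ⟨f, rfl⟩ := Ideal.Quotient.mkₐ_surjective A I x
    rw [sq_mk, ← hI.mem_iff hm] at hx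
    exact Ideal.Quotient.eq_zero_iff_mem.2 hx
  have sq_act : ∀ g x, sq (slActQuot I hI.slStable g x) =
      substBin B ((g⁻¹ : SL(2, ℂ)) : Matrix (Fin 2) (Fin 2) ℂ) (sq x) := by
    intro g x
    obtain ⟨f, rfl⟩ := Ideal.Quotient.mkₐ_surjective A I x
    rw [sq_mk, ← seg_substMat, ← slAct_eq]
    rfl
  let x₀ : BinForm d := ⟨MvPolynomial.X 0 ^ d, MvPolynomial.isHomogeneous_X_pow 0 d⟩
  let Φ : covariants I hI.slStable d →ₗ[A] B :=
    { toFun := fun φ => evalAt ![1, 0] (sq (φ.1 x₀))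
      map_add' := fun φ ψ => by simp
      map_smul' := fun a φ => by
        rw [← AlgHom.restrictScalars_apply A (evalAt ![1, 0])]
        simp only [Submodule.coe_smul, LinearMap.smul_apply, map_smul, RingHom.id_apply]
        rfl }
  have hΦ : ∀ (φ : covariants I hI.slStable d) p, sq (φ.1 p) =
      MvPolynomial.map (algebraMap ℂ B) p * MvPolynomial.C (Φ φ) := by
    intro φ
    obtain ⟨β, hβ⟩ := exists_eq_map_mul_C ((sq.restrictScalars ℂ).toLinearMap.comp φ.1) (by
      intro g p
      simp only [LinearMap.comp_apply, AlgHom.toLinearMap_apply, AlgHom.restrictScalars_apply]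
      rw [φ.2 g p, sq_act])
    have hβ' : ∀ p, sq (φ.1 p) = _ := hβ
    have : Φ φ = β := by
      change evalAt ![1, 0] (sq (φ.1 x₀)) = β
      rw [hβ']
      simp [x₀, evalAt]
    rw [this]
    exact hβ
  have hinj : Function.Injective Φ := by
    intro φ ψ h
    refine Subtype.ext (LinearMap.ext fun p => sq_inj ?_)
    rw [hΦ, hΦ, h]
  let Ψ : MvPolynomial.homogeneousSubmodule (Fin 6) A d →ₗ[A] B :=
    (Ideal.Quotient.mkₐ A N).toLinearMap.comp (Submodule.subtype _)
  have hker : LinearMap.ker Ψ = (N.restrictScalars A).comap (Submodule.subtype _) := by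
    ext c
    exact Ideal.Quotient.eq_zero_iff_mem
  -- The constant of a covariant is the class of the coefficient of `x^d` in a pullback, so it is
  -- represented by a form of degree `d`.
  have hrange : LinearMap.range Φ = LinearMap.range Ψ := by
    refine le_antisymm ?_ ?_
    · rintro _ ⟨φ, rfl⟩
      obtain ⟨f, hf⟩ := Ideal.Quotient.mkₐ_surjective A I (φ.1 x₀)
      have h1 := hΦ φ x₀
      rw [← hf, sq_mk, seg_eq_map] at h1
      have h2 := congrArg (MvPolynomial.coeff (Finsupp.single 0 d)) h1
      rw [MvPolynomial.coeff_map, mul_comm, MvPolynomial.coeff_C_mul] at h2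
      refine ⟨⟨_, ?_⟩, h2.trans ?_⟩
      · have := isHomogeneous_coeff_seg A f (Finsupp.single 0 d)
        rwa [Finsupp.degree_single] at this
      · simp [x₀, MvPolynomial.coeff_X_pow]
    · rintro _ ⟨⟨c, hc⟩, rfl⟩
      -- Conversely the products `p · c` lie in the image of `sq`. A left inverse that is merely
      -- `ℂ`-linear lifts them, and equivariance follows from the injectivity of `sq`.
      obtain ⟨r, hr⟩ := LinearMap.exists_leftInverse_of_injective
        (K := ℂ) (V := CoordRing A ⧸ I) (V' := MvPolynomial (Fin 2) B)
        (sq.restrictScalars ℂ).toLinearMap (LinearMap.ker_eq_bot.2 (by exact sq_inj))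
      have hr' : ∀ x, r (sq x) = x := fun x => DFunLike.congr_fun hr x
      let χ : BinForm d →ₗ[ℂ] MvPolynomial (Fin 2) B :=
        ((LinearMap.mulRight ℂ (MvPolynomial.C (Ideal.Quotient.mkₐ A N c))).comp
          (MvPolynomial.mapAlgHom (Algebra.ofId ℂ B)).toLinearMap).comp (Submodule.subtype _)
      have hχ : ∀ p : BinForm d, χ p = MvPolynomial.map (algebraMap ℂ B) p *
        MvPolynomial.C (Ideal.Quotient.mkₐ A N c) := fun p => rfl
      have hχr : ∀ p : BinForm d, sq (r (χ p)) = χ p := by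
        intro p
        obtain ⟨f, -, hf⟩ := exists_seg_eq (genPt N) ⊤ (fun _ _ _ _ => trivial) hc trivial p.2
        rw [aeval_genPt, ← hχ] at hf
        rw [← hf, ← sq_mk, hr']
      refine ⟨⟨r.comp χ, fun g p => sq_inj ?_⟩, ?_⟩
      · rw [sq_act]
        have h1 : ∀ q, sq ((r.comp χ) q) = χ q := hχr
        rw [h1, h1, hχ, hχ]
        change MvPolynomial.map _ (binAct g p) * _ = _
        rw [binAct_eq, map_substBin, map_mul]
        simp [substBin]
      · change evalAt ![1, 0] (sq (r (χ x₀))) = _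
        rw [hχr, hχ]
        simp [x₀, evalAt, Ψ]
  exact ⟨(LinearEquiv.ofInjective Φ hinj).trans ((LinearEquiv.ofEq _ _ hrange).trans
    ((LinearMap.quotKerEquivRange Ψ).symm.trans (Submodule.quotEquivOfEq _ _ hker)))⟩

/-! ### Locally free modules and base change -/

lemma IsLocallyFreeOfRank.of_equiv {A M M' : Type u} [CommRing A] [AddCommGroup M] [Module A M]
    [AddCommGroup M'] [Module A M'] {n : ℕ} (h : IsLocallyFreeOfRank A M n) (e : M ≃ₗ[A] M') :
    IsLocallyFreeOfRank A M' n := by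
  obtain ⟨h1, h2, h3⟩ := h
  exact ⟨Module.Finite.equiv e, Module.Projective.of_equiv e,
    fun p => by rw [← Module.rankAtStalk_eq_of_equiv e, h3]⟩

lemma IsLocallyFreeOfRank.of_isBaseChange {A B M M' : Type u} [CommRing A] [CommRing B]
    [Algebra A B] [AddCommGroup M] [Module A M] [AddCommGroup M'] [Module A M'] [Module B M']
    [IsScalarTower A B M'] {f : M →ₗ[A] M'} (hf : IsBaseChange B f) {n : ℕ}
    (h : IsLocallyFreeOfRank A M n) : IsLocallyFreeOfRank B M' n := by
  obtain ⟨h1, h2, h3⟩ := h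
  exact ⟨Module.Finite.equiv hf.equiv, Module.Projective.of_equiv hf.equiv,
    fun p => by rw [Module.rankAtStalk_isBaseChange hf, h3]⟩

/-- Over a field, local freeness of rank `n` means dimension `n`. -/
lemma isLocallyFreeOfRank_iff_finrank {K M : Type u} [Field K] [AddCommGroup M] [Module K M]
    [Module.Finite K M] {n : ℕ} : IsLocallyFreeOfRank K M n ↔ Module.finrank K M = n := by
  refine ⟨fun h => ?_, fun h => ⟨inferInstance, inferInstance, fun p => ?_⟩⟩
  · have := h.2.2 ⊥
    rwa [Module.rankAtStalk_eq_finrank_of_free] at this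
  · rw [Module.rankAtStalk_eq_finrank_of_free, ← h]
    rfl

/-- A surjection between locally free modules of the same rank is bijective. -/
lemma IsLocallyFreeOfRank.bijective_of_surjective {A M M' : Type u} [CommRing A] [AddCommGroup M]
    [Module A M] [AddCommGroup M'] [Module A M'] {n : ℕ} (h : IsLocallyFreeOfRank A M n)
    (h' : IsLocallyFreeOfRank A M' n) {φ : M →ₗ[A] M'} (hφ : Function.Surjective φ) :
    Function.Bijective φ := by
  obtain ⟨h1, h2, h3⟩ := h
  obtain ⟨h1', h2', h3'⟩ := h'
  exact Module.bijective_of_surjective_of_rankAtStalk_eq hφ fun m _ => by rw [h3, h3']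

/-- The map induced by `f` on the quotients by `N` and by the submodule generated by `f '' N`. -/
noncomputable def quotSpanMap {A : Type*} (B : Type*) {M M' : Type*} [CommRing A] [CommRing B]
    [Algebra A B]
    [AddCommGroup M] [Module A M] [AddCommGroup M'] [Module A M'] [Module B M']
    [IsScalarTower A B M'] (f : M →ₗ[A] M') (N : Submodule A M) :
    M ⧸ N →ₗ[A] M' ⧸ Submodule.span B (f '' N) :=
  N.liftQ (((Submodule.span B (f '' N)).mkQ.restrictScalars A).comp f) fun x hx =>
    (Submodule.Quotient.mk_eq_zero _).2 (Submodule.subset_span ⟨x, hx, rfl⟩)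

/-- This is the right exactness of extension of scalars, checked through the universal property. -/
lemma isBaseChange_quotSpanMap {A B : Type*} {M M' : Type*} [CommRing A] [CommRing B]
    [Algebra A B] [AddCommGroup M] [Module A M] [AddCommGroup M'] [Module A M'] [Module B M']
    [IsScalarTower A B M'] {f : M →ₗ[A] M'} (hf : IsBaseChange B f) (N : Submodule A M) :
    IsBaseChange B (quotSpanMap B f N) := by
  refine IsBaseChange.of_lift_unique _ fun Q _ _ _ _ g => ?_
  let := Module.addCommMonoidToAddCommGroup B (M := Q)
  let h := hf.lift (g.comp N.mkQ)
  have hh : ∀ x, h (f x) = g (N.mkQ x) := fun x => hf.lift_eq _ x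
  have hker : Submodule.span B (f '' N) ≤ LinearMap.ker h := by
    rw [Submodule.span_le]
    rintro _ ⟨x, hx, rfl⟩
    rw [SetLike.mem_coe, LinearMap.mem_ker, hh, Submodule.mkQ_apply,
      (Submodule.Quotient.mk_eq_zero N).2 hx, map_zero]
  refine ⟨(Submodule.span B (f '' N)).liftQ h hker, ?_, ?_⟩
  · refine LinearMap.ext fun x => ?_
    obtain ⟨x, rfl⟩ := N.mkQ_surjective x
    exact hh x
  · intro h' hh'
    refine Submodule.linearMap_qext _ ?_
    refine hf.algHom_ext _ _ fun x => ?_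
    refine (DFunLike.congr_fun hh' (N.mkQ x)).trans (hh x).symm

lemma isBaseChange_of_basis {A B ι : Type*} {M M' : Type*} [CommRing A] [CommRing B]
    [Algebra A B] [AddCommGroup M] [Module A M] [AddCommGroup M'] [Module A M'] [Module B M']
    [IsScalarTower A B M'] (f : M →ₗ[A] M') (b : Module.Basis ι A M) (b' : Module.Basis ι B M')
    (h : ∀ i, f (b i) = b' i) : IsBaseChange B f := by
  refine IsBaseChange.of_equiv ((b.baseChange B).equiv b' (Equiv.refl ι)) fun x => ?_
  have : (((b.baseChange B).equiv b' (Equiv.refl ι)).toLinearMap.restrictScalars A).comp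
      (TensorProduct.mk A B M 1) = f := by
    refine b.ext fun i => ?_
    rw [LinearMap.comp_apply, TensorProduct.mk_apply, LinearMap.restrictScalars_apply, h,
      ← Module.Basis.baseChange_apply, LinearEquiv.coe_coe, Module.Basis.equiv_apply,
      Equiv.refl_apply]
  exact DFunLike.congr_fun this x

lemma rankAtStalk_eq_finrank_of_isBaseChange {A M : Type*} [CommRing A] [AddCommGroup M]
    [Module A M] [Module.Finite A M] [Module.Projective A M] (p : PrimeSpectrum A) {M' : Type*}
    [AddCommGroup M'] [Module A M'] [Module p.asIdeal.ResidueField M']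
    [IsScalarTower A p.asIdeal.ResidueField M'] {f : M →ₗ[A] M'}
    (hf : IsBaseChange p.asIdeal.ResidueField f) :
    Module.rankAtStalk M p = Module.finrank p.asIdeal.ResidueField M' := by
  rw [Module.rankAtStalk_eq, hf.equiv.finrank_eq]

/-! ### Direct summands of `A⁶` -/

/-- The image of a matrix. -/
abbrev imageOf {A : Type*} [CommRing A] (P : Matrix (Fin 6) (Fin 6) A) :
    Submodule A (Fin 6 → A) :=
  LinearMap.range P.mulVecLin

/-- An image is generated by the columns of the matrix, and these are carried along by `f`. -/
lemma baseChange_imageOf {A B : Type u} [CommRing A] [CommRing B] (f : A →+* B)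
    (P : Matrix (Fin 6) (Fin 6) A) : baseChange f (imageOf P) = imageOf (P.map f) := by
  refine le_antisymm (Submodule.span_le.2 ?_) ?_
  · rintro _ ⟨_, ⟨v, rfl⟩, rfl⟩
    refine ⟨fun j => f (v j), ?_⟩
    ext i
    simp [Matrix.mulVec, dotProduct]
  · rintro _ ⟨w, rfl⟩
    have : (P.map f).mulVecLin w = ∑ j, w j • fun i => f (P i j) := by
      ext i
      simp [Matrix.mulVec, dotProduct, mul_comm]
    rw [this]
    refine Submodule.sum_mem _ fun j _ => Submodule.smul_mem _ _ (Submodule.subset_span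
      ⟨P.mulVecLin (Pi.single j 1), ⟨_, rfl⟩, ?_⟩)
    ext i
    simp

lemma isBaseChange_pi (A B : Type*) [CommRing A] [CommRing B] [Algebra A B] :
    IsBaseChange B ((Algebra.linearMap A B).compLeft (Fin 6)) :=
  (IsBaseChange.linearMap A B).finitePow (Fin 6)

lemma baseChange_eq_span {A B : Type u} [CommRing A] [CommRing B] [Algebra A B]
    (U : Submodule A (Fin 6 → A)) : baseChange (algebraMap A B) U =
      Submodule.span B ((Algebra.linearMap A B).compLeft (Fin 6) '' U) := by
  have : {w : Fin 6 → B | ∃ v ∈ U, w = fun j => algebraMap A B (v j)} =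
      (Algebra.linearMap A B).compLeft (Fin 6) '' U := by
    ext w
    constructor
    · rintro ⟨v, hv, rfl⟩
      exact ⟨v, hv, rfl⟩
    · rintro ⟨v, hv, rfl⟩
      exact ⟨v, hv, rfl⟩
  rw [baseChange, this]

lemma exists_isBaseChange_quotient (A B : Type u) [CommRing A] [CommRing B] [Algebra A B]
    (U : Submodule A (Fin 6 → A)) :
    ∃ f : ((Fin 6 → A) ⧸ U) →ₗ[A] ((Fin 6 → B) ⧸ baseChange (algebraMap A B) U),
      IsBaseChange B f := by
  rw [baseChange_eq_span]
  have h := isBaseChange_quotSpanMap (isBaseChange_pi A B) U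
  exact ⟨quotSpanMap B ((Algebra.linearMap A B).compLeft (Fin 6)) U, h⟩

/-- A section `h` of the quotient map gives the projector `v ↦ v - h (v mod U)` onto `U`. An
idempotent matrix stays idempotent under every ring homomorphism. -/
lemma exists_isIdempotentElem_of_projective {A : Type*} [CommRing A] (U : Submodule A (Fin 6 → A))
    [Module.Projective A ((Fin 6 → A) ⧸ U)] :
    ∃ P : Matrix (Fin 6) (Fin 6) A, P * P = P ∧ U = imageOf P := by
  obtain ⟨h, hh⟩ := Module.projective_lifting_property U.mkQ LinearMap.id U.mkQ_surjective
  have hU : ∀ v, v - h (U.mkQ v) ∈ U := by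
    intro v
    rw [← Submodule.Quotient.mk_eq_zero, Submodule.Quotient.mk_sub, sub_eq_zero]
    exact (DFunLike.congr_fun hh (U.mkQ v)).symm
  have hU' : ∀ v ∈ U, v - h (U.mkQ v) = v := by
    intro v hv
    rw [Submodule.mkQ_apply, (Submodule.Quotient.mk_eq_zero U).2 hv, map_zero, sub_zero]
  let L : (Fin 6 → A) →ₗ[A] (Fin 6 → A) := LinearMap.id - h.comp U.mkQ
  have hL : (LinearMap.toMatrix' L).mulVecLin = L := by
    rw [← Matrix.toLin'_apply', Matrix.toLin'_toMatrix']
  refine ⟨LinearMap.toMatrix' L, ?_, ?_⟩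
  · rw [← LinearMap.toMatrix'_comp]
    congr 1
    exact LinearMap.ext fun v => hU' _ (hU v)
  · rw [imageOf, hL]
    refine le_antisymm (fun v hv => ⟨v, hU' v hv⟩) ?_
    rintro _ ⟨v, rfl⟩
    exact hU v

lemma mem_imageOf_iff {A : Type*} [CommRing A] {P : Matrix (Fin 6) (Fin 6) A} (hP : P * P = P)
    (v : Fin 6 → A) : v ∈ imageOf P ↔ P *ᵥ v = v := by
  refine ⟨?_, fun h => ⟨v, h⟩⟩
  rintro ⟨w, rfl⟩
  rw [Matrix.mulVecLin_apply, Matrix.mulVec_mulVec, hP]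

lemma projective_quotient_imageOf {A : Type*} [CommRing A] {P : Matrix (Fin 6) (Fin 6) A}
    (hP : P * P = P) : Module.Projective A ((Fin 6 → A) ⧸ imageOf P) := by
  refine Module.Projective.of_split ((imageOf P).liftQ (1 - P).mulVecLin ?_) (imageOf P).mkQ ?_
  · rintro _ ⟨v, rfl⟩
    rw [LinearMap.mem_ker, Matrix.mulVecLin_apply, Matrix.mulVecLin_apply, Matrix.mulVec_mulVec,
      sub_mul, one_mul, hP, sub_self, Matrix.zero_mulVec]
  · refine Submodule.linearMap_qext _ (LinearMap.ext fun v => ?_)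
    simp only [LinearMap.comp_apply, Submodule.mkQ_apply, Submodule.liftQ_apply, LinearMap.id_apply]
    rw [Submodule.Quotient.eq]
    refine ⟨-v, ?_⟩
    simp [Matrix.mulVec_neg]

/-- The quotient by the image of an idempotent matrix is locally free of rank `n` if and only if
the matrix has rank `6 - n` at every point. -/
lemma isLocallyFreeOfRank_quotient_imageOf_iff {A : Type u} [CommRing A]
    {P : Matrix (Fin 6) (Fin 6) A} (hP : P * P = P) (n : ℕ) :
    IsLocallyFreeOfRank A ((Fin 6 → A) ⧸ imageOf P) n ↔ ∀ p : PrimeSpectrum A,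
      n + (P.map (algebraMap A p.asIdeal.ResidueField)).rank = 6 := by
  have := projective_quotient_imageOf hP
  have key : ∀ p : PrimeSpectrum A, Module.rankAtStalk ((Fin 6 → A) ⧸ imageOf P) p +
      (P.map (algebraMap A p.asIdeal.ResidueField)).rank = 6 := by
    intro p
    obtain ⟨f, hf⟩ := exists_isBaseChange_quotient A p.asIdeal.ResidueField (imageOf P)
    rw [rankAtStalk_eq_finrank_of_isBaseChange p hf, baseChange_imageOf, Matrix.rank,
      Submodule.finrank_quotient_add_finrank, Module.finrank_fin_fun]
  refine ⟨fun h p => ?_, fun h => ⟨inferInstance, this, fun p => ?_⟩⟩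
  · rw [← h.2.2 p, key]
  · have := key p
    have := h p
    omega

/-! ### Orthogonal complements -/

lemma matQ_mul_self (A : Type*) [CommRing A] : matQ A * matQ A = 1 := by
  ext i j
  fin_cases i <;> fin_cases j <;> simp [matQ, Matrix.mul_apply, Fin.sum_univ_succ]

lemma matQ_transpose (A : Type*) [CommRing A] : (matQ A)ᵀ = matQ A := by
  ext i j
  fin_cases i <;> fin_cases j <;> rfl

lemma matQ_map {A B : Type*} [CommRing A] [CommRing B] (f : A →+* B) :
    (matQ A).map f = matQ B := by
  ext i j
  fin_cases i <;> fin_cases j <;> simp [matQ]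

lemma formQ_apply {A : Type*} [CommRing A] (v w : Fin 6 → A) :
    formQ A v w = v ⬝ᵥ matQ A *ᵥ w :=
  Matrix.toBilin'_apply' _ _ _

/-- The adjoint of a matrix with respect to the form `Q`. -/
def adjQ {A : Type*} [CommRing A] (P : Matrix (Fin 6) (Fin 6) A) : Matrix (Fin 6) (Fin 6) A :=
  matQ A * Pᵀ * matQ A

lemma adjQ_mul {A : Type*} [CommRing A] (P R : Matrix (Fin 6) (Fin 6) A) :
    adjQ (P * R) = adjQ R * adjQ P := by
  simp only [adjQ, Matrix.transpose_mul, Matrix.mul_assoc]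
  rw [← Matrix.mul_assoc (matQ A) (matQ A), matQ_mul_self, Matrix.one_mul]

lemma adjQ_adjQ {A : Type*} [CommRing A] (P : Matrix (Fin 6) (Fin 6) A) : adjQ (adjQ P) = P := by
  simp only [adjQ, Matrix.transpose_mul, Matrix.mul_assoc, Matrix.transpose_transpose,
    matQ_transpose, matQ_mul_self, Matrix.mul_one]
  rw [← Matrix.mul_assoc, matQ_mul_self, Matrix.one_mul]

lemma adjQ_one_sub {A : Type*} [CommRing A] (P : Matrix (Fin 6) (Fin 6) A) :
    adjQ (1 - P) = 1 - adjQ P := by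
  simp only [adjQ, Matrix.transpose_sub, Matrix.transpose_one, mul_sub, sub_mul, mul_one,
    matQ_mul_self]

lemma adjQ_map {A B : Type*} [CommRing A] [CommRing B] (f : A →+* B)
    (P : Matrix (Fin 6) (Fin 6) A) : (adjQ P).map f = adjQ (P.map f) := by
  simp only [adjQ, Matrix.map_mul, matQ_map, Matrix.transpose_map]

lemma formQ_mulVec {A : Type*} [CommRing A] (P : Matrix (Fin 6) (Fin 6) A) (v w : Fin 6 → A) :
    formQ A (P *ᵥ v) w = formQ A v (adjQ P *ᵥ w) := by
  rw [formQ_apply, formQ_apply, adjQ, Matrix.mulVec_mulVec, Matrix.mul_assoc,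
    ← Matrix.mul_assoc, matQ_mul_self, Matrix.one_mul, ← Matrix.mulVec_mulVec,
    Matrix.dotProduct_mulVec v, Matrix.vecMul_transpose]

lemma eq_zero_of_formQ {A : Type*} [CommRing A] {w : Fin 6 → A} (h : ∀ v, formQ A v w = 0) :
    w = 0 := by
  have h1 : matQ A *ᵥ w = 0 := by
    ext i
    have := h (Pi.single i 1)
    rwa [formQ_apply, single_one_dotProduct] at this
  rw [← Matrix.one_mulVec w, ← matQ_mul_self, ← Matrix.mulVec_mulVec, h1, Matrix.mulVec_zero]

lemma one_sub_mul_self {A : Type*} [CommRing A] {P : Matrix (Fin 6) (Fin 6) A} (hP : P * P = P) :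
    (1 - P) * (1 - P) = 1 - P := by
  rw [mul_sub, sub_mul, sub_mul, hP]
  simp

lemma adjQ_mul_self {A : Type*} [CommRing A] {P : Matrix (Fin 6) (Fin 6) A} (hP : P * P = P) :
    adjQ P * adjQ P = adjQ P := by
  rw [← adjQ_mul, hP]

/-- By adjunction and nondegeneracy the complement is the kernel of the idempotent `adjQ P`, hence
the image of `1 - adjQ P`. -/
lemma orthogonal_imageOf {A : Type*} [CommRing A] {P : Matrix (Fin 6) (Fin 6) A}
    (hP : P * P = P) : (formQ A).orthogonal (imageOf P) = imageOf (1 - adjQ P) := by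
  ext v
  rw [LinearMap.BilinForm.mem_orthogonal_iff, mem_imageOf_iff (one_sub_mul_self (adjQ_mul_self hP)),
    Matrix.sub_mulVec, Matrix.one_mulVec, sub_eq_self]
  refine ⟨fun h => eq_zero_of_formQ fun w => ?_, ?_⟩
  · rw [← formQ_mulVec]
    exact h _ ⟨w, rfl⟩
  · rintro h _ ⟨w, rfl⟩
    rw [Matrix.mulVecLin_apply, formQ_mulVec, h, map_zero]

lemma orthogonal_orthogonal {A : Type*} [CommRing A] (U : Submodule A (Fin 6 → A))
    [Module.Projective A ((Fin 6 → A) ⧸ U)] :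
    (formQ A).orthogonal ((formQ A).orthogonal U) = U := by
  obtain ⟨P, hP, rfl⟩ := exists_isIdempotentElem_of_projective U
  rw [orthogonal_imageOf hP, orthogonal_imageOf (one_sub_mul_self (adjQ_mul_self hP)),
    adjQ_one_sub, adjQ_adjQ, sub_sub_cancel]

lemma rank_adjQ {K : Type*} [Field K] (P : Matrix (Fin 6) (Fin 6) K) :
    (adjQ P).rank = P.rank := by
  have hQ : IsUnit (matQ K).det := by
    rw [← Matrix.isUnit_iff_isUnit_det]
    exact .of_mul_eq_one _ (matQ_mul_self K)
  rw [adjQ, Matrix.rank_mul_eq_left_of_isUnit_det _ _ hQ,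
    Matrix.rank_mul_eq_right_of_isUnit_det _ _ hQ, Matrix.rank_transpose]

lemma rank_one_sub {K : Type*} [Field K] {P : Matrix (Fin 6) (Fin 6) K} (hP : P * P = P) :
    (1 - P).rank + P.rank = 6 := by
  have : LinearMap.range (1 - P).mulVecLin = LinearMap.ker P.mulVecLin := by
    ext v
    rw [mem_imageOf_iff (one_sub_mul_self hP), Matrix.sub_mulVec, Matrix.one_mulVec, sub_eq_self,
      LinearMap.mem_ker, Matrix.mulVecLin_apply]
  rw [Matrix.rank, Matrix.rank, this, add_comm, LinearMap.finrank_range_add_finrank_ker,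
    Module.finrank_fin_fun]

/-- At each prime the projector `1 - adjQ P` has rank six minus the rank of `P`. -/
lemma isLocallyFreeOfRank_quotient_orthogonal {A : Type u} [CommRing A]
    {U : Submodule A (Fin 6 → A)} {n m : ℕ} (h : IsLocallyFreeOfRank A ((Fin 6 → A) ⧸ U) n)
    (hnm : n + m = 6) :
    IsLocallyFreeOfRank A ((Fin 6 → A) ⧸ (formQ A).orthogonal U) m := by
  have := h.2.1
  obtain ⟨P, hP, rfl⟩ := exists_isIdempotentElem_of_projective U
  rw [isLocallyFreeOfRank_quotient_imageOf_iff hP] at h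
  rw [orthogonal_imageOf hP,
    isLocallyFreeOfRank_quotient_imageOf_iff (one_sub_mul_self (adjQ_mul_self hP))]
  intro p
  have h1 := h p
  have hmap := congrArg (fun M => M.map (algebraMap A p.asIdeal.ResidueField)) hP
  rw [Matrix.map_mul] at hmap
  have h2 := rank_one_sub (adjQ_mul_self hmap)
  rw [rank_adjQ] at h2
  have h3 : (1 - adjQ P).map (algebraMap A p.asIdeal.ResidueField) =
      1 - adjQ (P.map (algebraMap A p.asIdeal.ResidueField)) := by
    rw [← adjQ_map, Matrix.map_sub _ (map_sub _), Matrix.map_one _ (map_zero _) (map_one _)]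
  rw [h3]
  omega

/-- For arbitrary submodules this fails; for direct summands both sides are the image of one matrix.
-/
lemma baseChange_orthogonal {A B : Type u} [CommRing A] [CommRing B] (f : A →+* B)
    (U : Submodule A (Fin 6 → A)) [Module.Projective A ((Fin 6 → A) ⧸ U)] :
    (formQ B).orthogonal (baseChange f U) = baseChange f ((formQ A).orthogonal U) := by
  obtain ⟨P, hP, rfl⟩ := exists_isIdempotentElem_of_projective U
  have hmap := congrArg (fun M => M.map f) hP
  rw [Matrix.map_mul] at hmap
  rw [orthogonal_imageOf hP, baseChange_imageOf, baseChange_imageOf, orthogonal_imageOf hmap,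
    Matrix.map_sub _ (map_sub _), Matrix.map_one _ (map_zero _) (map_one _), adjQ_map]

/-! ### Symmetric powers of direct summands -/

/-- The linear form with coefficient vector `v`. -/
noncomputable def linForm (A : Type*) [CommRing A] :
    (Fin 6 → A) →ₗ[A] MvPolynomial (Fin 6) A :=
  Fintype.linearCombination A MvPolynomial.X

lemma linForm_apply {A : Type*} [CommRing A] (v : Fin 6 → A) :
    linForm A v = ∑ j, MvPolynomial.C (v j) * MvPolynomial.X j := by
  simp only [linForm, Fintype.linearCombination_apply, MvPolynomial.smul_eq_C_mul]

lemma linForm_single {A : Type*} [CommRing A] (j : Fin 6) :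
    linForm A (Pi.single j 1) = MvPolynomial.X j := by
  rw [linForm, Fintype.linearCombination_apply_single, one_smul]

/-- The ideal generated by the linear forms with coefficient vectors in `V`. -/
noncomputable def formIdeal {A : Type*} [CommRing A] (V : Submodule A (Fin 6 → A)) :
    Ideal (MvPolynomial (Fin 6) A) :=
  Ideal.span (linForm A '' V)

lemma linForm_mem_formIdeal {A : Type*} [CommRing A] {V : Submodule A (Fin 6 → A)}
    {v : Fin 6 → A} (hv : v ∈ V) : linForm A v ∈ formIdeal V :=
  Ideal.subset_span ⟨v, hv, rfl⟩

/-- The substitution `z_j ↦ ∑ M_{ij} z_i`. -/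
noncomputable def linSubst {A ι κ : Type*} [CommRing A] [Fintype ι] (M : Matrix ι κ A) :
    MvPolynomial κ A →ₐ[A] MvPolynomial ι A :=
  MvPolynomial.aeval fun j => ∑ i, MvPolynomial.C (M i j) * MvPolynomial.X i

lemma linSubst_mul {A ι κ τ : Type*} [CommRing A] [Fintype ι] [Fintype κ] (M : Matrix ι κ A)
    (N : Matrix κ τ A) (f : MvPolynomial τ A) :
    linSubst M (linSubst N f) = linSubst (M * N) f := by
  have : (linSubst M).comp (linSubst N) = linSubst (M * N) := by
    refine MvPolynomial.algHom_ext fun j => ?_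
    simp only [linSubst, AlgHom.comp_apply, MvPolynomial.aeval_X, map_sum, map_mul,
      MvPolynomial.algHom_C, MvPolynomial.algebraMap_eq, Matrix.mul_apply, Finset.mul_sum,
      Finset.sum_mul]
    rw [Finset.sum_comm]
    refine Finset.sum_congr rfl fun i _ => Finset.sum_congr rfl fun k _ => ?_
    ring
  exact DFunLike.congr_fun this f

lemma linSubst_one {A ι : Type*} [CommRing A] [Fintype ι] [DecidableEq ι] (f : MvPolynomial ι A) :
    linSubst (1 : Matrix ι ι A) f = f := by
  have : linSubst (1 : Matrix ι ι A) = AlgHom.id A _ := by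
    refine MvPolynomial.algHom_ext fun j => ?_
    rw [linSubst, MvPolynomial.aeval_X, Finset.sum_eq_single j]
    · simp
    · intro i _ hi
      simp [Matrix.one_apply_ne hi]
    · simp
  rw [this, AlgHom.id_apply]

lemma isHomogeneous_linSubst {A ι κ : Type*} [CommRing A] [Fintype ι] (M : Matrix ι κ A) {d : ℕ}
    {f : MvPolynomial κ A} (hf : f.IsHomogeneous d) : (linSubst M f).IsHomogeneous d := by
  rw [← one_mul d]
  exact hf.aeval _ fun j => MvPolynomial.IsHomogeneous.sum _ _ _ fun i _ =>
    zero_add 1 ▸ (MvPolynomial.isHomogeneous_C ι (M i j)).mul (MvPolynomial.isHomogeneous_X A i)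

lemma linSubst_linForm {A : Type*} [CommRing A] (M : Matrix (Fin 6) (Fin 6) A) (v : Fin 6 → A) :
    linSubst M (linForm A v) = linForm A (M *ᵥ v) := by
  simp only [linForm_apply, linSubst, map_sum, map_mul, MvPolynomial.algHom_C,
    MvPolynomial.algebraMap_eq, MvPolynomial.aeval_X, Matrix.mulVec, dotProduct, Finset.mul_sum,
    Finset.sum_mul]
  rw [Finset.sum_comm]
  refine Finset.sum_congr rfl fun i _ => Finset.sum_congr rfl fun k _ => ?_
  ring

lemma map_linSubst {A B : Type*} [CommRing A] [CommRing B] (f : A →+* B)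
    (M : Matrix (Fin 6) (Fin 6) A) (c : MvPolynomial (Fin 6) A) :
    MvPolynomial.map f (linSubst M c) = linSubst (M.map f) (MvPolynomial.map f c) := by
  have : (MvPolynomial.map f).comp (linSubst M).toRingHom =
      (linSubst (M.map f)).toRingHom.comp (MvPolynomial.map f) := by
    refine MvPolynomial.ringHom_ext (fun r => ?_) fun k => ?_
    · simp [linSubst]
    · simp [linSubst]
  exact DFunLike.congr_fun this c

lemma sub_linSubst_mem {A : Type*} [CommRing A] {F : Matrix (Fin 6) (Fin 6) A}
    (c : MvPolynomial (Fin 6) A) : c - linSubst (1 - F) c ∈ formIdeal (imageOf F) := by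
  rw [← Ideal.Quotient.eq]
  have : (Ideal.Quotient.mkₐ A (formIdeal (imageOf F))).comp (linSubst (1 - F)) =
      Ideal.Quotient.mkₐ A (formIdeal (imageOf F)) := by
    refine MvPolynomial.algHom_ext fun j => ?_
    rw [AlgHom.comp_apply, ← linForm_single, linSubst_linForm, Ideal.Quotient.mkₐ_eq_mk, eq_comm,
      Ideal.Quotient.eq, ← map_sub]
    refine linForm_mem_formIdeal ⟨Pi.single j 1, ?_⟩
    rw [Matrix.sub_mulVec, Matrix.one_mulVec, sub_sub_cancel, Matrix.mulVecLin_apply]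
  exact (DFunLike.congr_fun this c).symm

/-- Substituting `1 - F` kills the forms of `imageOf F` and alters any polynomial only by an element
of the ideal. The ideal is thus the kernel of an idempotent endomorphism, and membership becomes an
equation. -/
lemma mem_formIdeal_iff {A : Type*} [CommRing A] {F : Matrix (Fin 6) (Fin 6) A} (hF : F * F = F)
    (c : MvPolynomial (Fin 6) A) : c ∈ formIdeal (imageOf F) ↔ linSubst (1 - F) c = 0 := by
  constructor
  · intro hc
    have : formIdeal (imageOf F) ≤ RingHom.ker (linSubst (1 - F)) := by
      refine Ideal.span_le.2 ?_
      rintro _ ⟨_, ⟨v, rfl⟩, rfl⟩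
      rw [SetLike.mem_coe, RingHom.mem_ker, linSubst_linForm, Matrix.mulVecLin_apply,
        Matrix.mulVec_mulVec, sub_mul, one_mul, hF, sub_self, Matrix.zero_mulVec, map_zero]
    exact this hc
  · intro hc
    simpa [hc] using sub_linSubst_mem (F := F) c

/-- The monomials of degree `d` form a basis of the module of forms of degree `d`. -/
noncomputable def formBasis (ι A : Type*) [CommRing A] (d : ℕ) :
    Module.Basis {m : ι →₀ ℕ // m.degree = d} A (MvPolynomial.homogeneousSubmodule ι A d) :=
  Module.Basis.mk (v := fun m => ⟨MvPolynomial.monomial m.1 1,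
      MvPolynomial.isHomogeneous_monomial 1 m.2⟩)
    (by
      refine LinearIndependent.of_comp (Submodule.subtype _) ?_
      have := (MvPolynomial.basisMonomials ι A).linearIndependent.comp
        (Subtype.val : {m : ι →₀ ℕ // m.degree = d} → _) Subtype.val_injective
      rwa [MvPolynomial.coe_basisMonomials] at this)
    (by
      rintro ⟨p, hp⟩ -
      have hd : ∀ m ∈ p.support, m.degree = d := fun m hm => by
        rw [Finsupp.degree_eq_weight_one]
        exact hp (MvPolynomial.mem_support_iff.1 hm)
      have h1 : (⟨p, hp⟩ : MvPolynomial.homogeneousSubmodule ι A d) =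
          ∑ m ∈ p.support.attach, MvPolynomial.coeff m.1 p •
            ⟨MvPolynomial.monomial m.1 1,
              MvPolynomial.isHomogeneous_monomial 1 (hd m.1 m.2)⟩ := by
        refine Subtype.ext ?_
        rw [Submodule.coe_sum]
        simp only [Submodule.coe_smul, MvPolynomial.smul_monomial, smul_eq_mul, mul_one]
        rw [Finset.sum_attach p.support fun m => MvPolynomial.monomial m (MvPolynomial.coeff m p)]
        exact p.as_sum
      rw [h1]
      exact Submodule.sum_mem _ fun m _ => Submodule.smul_mem _ _ (Submodule.subset_span
        ⟨⟨m.1, hd m.1 m.2⟩, rfl⟩))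

lemma coe_formBasis {ι A : Type*} [CommRing A] (d : ℕ) (m : {m : ι →₀ ℕ // m.degree = d}) :
    (formBasis ι A d m : MvPolynomial ι A) = MvPolynomial.monomial m.1 1 := by
  rw [formBasis, Module.Basis.mk_apply]

lemma finrank_binaryForms (K : Type*) [Field K] (d : ℕ) :
    Module.finrank K (MvPolynomial.homogeneousSubmodule (Fin 2) K d) = d + 1 := by
  let e : {m : Fin 2 →₀ ℕ // m.degree = d} ≃ Fin (d + 1) :=
    { toFun := fun m => ⟨m.1 0, by
        have := m.2
        rw [Finsupp.degree_eq_sum, Fin.sum_univ_two] at this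
        omega⟩
      invFun := fun i => ⟨Finsupp.single 0 i.1 + Finsupp.single 1 (d - i.1), by
        rw [map_add, Finsupp.degree_single, Finsupp.degree_single]
        omega⟩
      left_inv := fun m => by
        have := m.2
        rw [Finsupp.degree_eq_sum, Fin.sum_univ_two] at this
        refine Subtype.ext (Finsupp.ext fun k => ?_)
        fin_cases k
        · simp
        · simp
          omega
      right_inv := fun i => by
        refine Fin.ext ?_
        simp }
  rw [Module.finrank_eq_nat_card_basis (formBasis (Fin 2) K d), Nat.card_congr e, Nat.card_fin]

instance finite_forms (A : Type*) [CommRing A] (d : ℕ) :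
    Module.Finite A (MvPolynomial.homogeneousSubmodule (Fin 6) A d) :=
  Module.Finite.iff_fg.2 (MvPolynomial.homogeneousSubmodule_fg (Fin 6) A d)

instance free_forms (A : Type*) [CommRing A] (d : ℕ) :
    Module.Free A (MvPolynomial.homogeneousSubmodule (Fin 6) A d) :=
  Module.Free.of_basis (formBasis (Fin 6) A d)

/-- The forms of degree `d` in `N`. -/
noncomputable abbrev formsIn {A : Type u} [CommRing A] (N : Ideal (MvPolynomial (Fin 6) A)) (d : ℕ) :
    Submodule A (MvPolynomial.homogeneousSubmodule (Fin 6) A d) :=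
  (N.restrictScalars A).comap (MvPolynomial.homogeneousSubmodule (Fin 6) A d).subtype

/-- The substitution `z_j ↦ ∑ M_{ij} z_i` on forms of degree `d`. -/
noncomputable def linSubstForms {A ι κ : Type*} [CommRing A] [Fintype ι] (M : Matrix ι κ A)
    (d : ℕ) : MvPolynomial.homogeneousSubmodule κ A d →ₗ[A]
      MvPolynomial.homogeneousSubmodule ι A d :=
  (linSubst M).toLinearMap.restrict fun _ hf => isHomogeneous_linSubst M hf

lemma projective_gradedQuot {A : Type u} [CommRing A] {F : Matrix (Fin 6) (Fin 6) A}
    (hF : F * F = F) (d : ℕ) : Module.Projective A (gradedQuot (formIdeal (imageOf F)) d) := by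
  refine Module.Projective.of_split ((formsIn (formIdeal (imageOf F)) d).liftQ
    (linSubstForms (1 - F) d) ?_) (formsIn (formIdeal (imageOf F)) d).mkQ ?_
  · intro c hc
    exact Subtype.ext ((mem_formIdeal_iff hF c.1).1 hc)
  · refine Submodule.linearMap_qext _ (LinearMap.ext fun c => ?_)
    simp only [LinearMap.comp_apply, Submodule.mkQ_apply, LinearMap.id_apply]
    rw [eq_comm, Submodule.Quotient.eq]
    exact sub_linSubst_mem c.1

/-- The extension of scalars of forms of degree `d`. -/
noncomputable def mapForms (A B : Type*) [CommRing A] [CommRing B] [Algebra A B] (d : ℕ) :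
    MvPolynomial.homogeneousSubmodule (Fin 6) A d →ₗ[A]
      MvPolynomial.homogeneousSubmodule (Fin 6) B d where
  toFun c := ⟨MvPolynomial.map (algebraMap A B) c.1, c.2.map _⟩
  map_add' c e := Subtype.ext (map_add _ _ _)
  map_smul' a c := Subtype.ext (by
    change MvPolynomial.map (algebraMap A B) (a • c.1) = a • MvPolynomial.map (algebraMap A B) c.1
    rw [MvPolynomial.smul_eq_C_mul, map_mul, MvPolynomial.map_C, ← algebraMap_smul B a,
      MvPolynomial.smul_eq_C_mul])

lemma isBaseChange_mapForms (A B : Type*) [CommRing A] [CommRing B] [Algebra A B] (d : ℕ) :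
    IsBaseChange B (mapForms A B d) := by
  refine isBaseChange_of_basis _ (formBasis (Fin 6) A d) (formBasis (Fin 6) B d) fun m => ?_
  refine Subtype.ext ?_
  rw [coe_formBasis]
  change MvPolynomial.map _ (formBasis (Fin 6) A d m).1 = _
  rw [coe_formBasis, MvPolynomial.map_monomial, map_one]

/-- Both sides are the image of the projector `c ↦ c - linSubst (1 - F) c` on forms of degree `d`,
which is defined over `A`. -/
lemma formsIn_map {A B : Type u} [CommRing A] [CommRing B] [Algebra A B]
    {F : Matrix (Fin 6) (Fin 6) A} (hF : F * F = F) (d : ℕ) :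
    formsIn (formIdeal (imageOf (F.map (algebraMap A B)))) d =
      Submodule.span B (mapForms A B d '' formsIn (formIdeal (imageOf F)) d) := by
  have hF' := congrArg (fun M => M.map (algebraMap A B)) hF
  rw [Matrix.map_mul] at hF'
  have h1F : (1 - F).map (algebraMap A B) = 1 - F.map (algebraMap A B) := by
    rw [Matrix.map_sub _ (map_sub _), Matrix.map_one _ (map_zero _) (map_one _)]
  have hcomm : ∀ c, linSubstForms (1 - F.map (algebraMap A B)) d (mapForms A B d c) =
      mapForms A B d (linSubstForms (1 - F) d c) := fun c =>
    Subtype.ext (by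
      change linSubst _ (MvPolynomial.map _ _) = MvPolynomial.map _ (linSubst _ _)
      rw [map_linSubst, h1F]
      rfl)
  refine le_antisymm ?_ (Submodule.span_le.2 ?_)
  · intro c hc
    have h0 : linSubstForms (1 - F.map (algebraMap A B)) d c = 0 :=
      Subtype.ext ((mem_formIdeal_iff hF' c.1).1 hc)
    have key : ∀ c, c - linSubstForms (1 - F.map (algebraMap A B)) d c ∈
        Submodule.span B (mapForms A B d '' formsIn (formIdeal (imageOf F)) d) := by
      intro c
      induction c using (isBaseChange_mapForms A B d).inductionOn with
      | zero => simp
      | tmul e =>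
        rw [hcomm, ← map_sub]
        exact Submodule.subset_span ⟨_, sub_linSubst_mem e.1, rfl⟩
      | smul s e he =>
        rw [map_smul, ← smul_sub]
        exact Submodule.smul_mem _ _ he
      | add e e' he he' =>
        rw [map_add, add_sub_add_comm]
        exact Submodule.add_mem _ he he'
    simpa [h0] using key c
  · rintro _ ⟨c, hc, rfl⟩
    have h0 : linSubstForms (1 - F) d c = 0 := Subtype.ext ((mem_formIdeal_iff hF c.1).1 hc)
    refine (mem_formIdeal_iff hF' _).2 ?_
    have := hcomm c
    rw [h0, map_zero] at this
    exact congrArg Subtype.val this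

lemma exists_factorization {K : Type*} [Field K] {E : Matrix (Fin 6) (Fin 6) K} (hE : E * E = E)
    {n : ℕ} (hn : E.rank = n) :
    ∃ (C : Matrix (Fin 6) (Fin n) K) (D : Matrix (Fin n) (Fin 6) K), C * D = E ∧ D * C = 1 := by
  have e : LinearMap.range E.mulVecLin ≃ₗ[K] (Fin n → K) :=
    LinearEquiv.ofFinrankEq _ _ (by rw [Module.finrank_fin_fun, ← hn, Matrix.rank])
  let c : (Fin n → K) →ₗ[K] (Fin 6 → K) := (Submodule.subtype _).comp e.symm.toLinearMap
  let δ : (Fin 6 → K) →ₗ[K] (Fin n → K) := e.toLinearMap.comp E.mulVecLin.rangeRestrict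
  refine ⟨LinearMap.toMatrix' c, LinearMap.toMatrix' δ, ?_, ?_⟩
  · rw [← LinearMap.toMatrix'_comp]
    have : c.comp δ = Matrix.toLin' E := by
      refine LinearMap.ext fun v => ?_
      simp [c, δ]
    rw [this, LinearMap.toMatrix'_toLin']
  · rw [← LinearMap.toMatrix'_comp]
    have : δ.comp c = LinearMap.id := by
      refine LinearMap.ext fun v => ?_
      have h1 : E.mulVecLin.rangeRestrict (e.symm v).1 = e.symm v :=
        Subtype.ext ((mem_imageOf_iff hE _).1 (e.symm v).2)
      change e (E.mulVecLin.rangeRestrict (e.symm v).1) = v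
      rw [h1, LinearEquiv.apply_symm_apply]
    rw [this, LinearMap.toMatrix'_id]

/-- Factoring `1 - F` through `K²` identifies the quotient by the linear forms with a polynomial
ring in two variables. -/
lemma finrank_gradedQuot {K : Type u} [Field K] {F : Matrix (Fin 6) (Fin 6) K} (hF : F * F = F)
    (hrank : (1 - F).rank = 2) (d : ℕ) :
    Module.finrank K (gradedQuot (formIdeal (imageOf F)) d) = d + 1 := by
  obtain ⟨C, D, hCD, hDC⟩ := exists_factorization (one_sub_mul_self hF) hrank
  have hker : LinearMap.ker (linSubstForms D d) = formsIn (formIdeal (imageOf F)) d := by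
    ext c
    rw [LinearMap.mem_ker]
    refine Iff.trans ?_ (mem_formIdeal_iff hF c.1).symm
    rw [← hCD, ← linSubst_mul]
    refine ⟨fun h => ?_, fun h => Subtype.ext ?_⟩
    · have : linSubst D c.1 = 0 := congrArg Subtype.val h
      rw [this, map_zero]
    · have := congrArg (linSubst D) h
      rw [linSubst_mul, hDC, linSubst_one, map_zero] at this
      exact this
  have hsurj : Function.Surjective (linSubstForms D d) := by
    intro c
    refine ⟨linSubstForms C d c, Subtype.ext ?_⟩
    change linSubst D (linSubst C c.1) = c.1
    rw [linSubst_mul, hDC, linSubst_one]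
  rw [← finrank_binaryForms K d]
  exact ((Submodule.quotEquivOfEq _ _ hker.symm).trans
    ((linSubstForms D d).quotKerEquivOfSurjective hsurj)).finrank_eq

/-- The symmetric powers of a locally free module of rank two are locally free. -/
lemma isLocallyFreeOfRank_gradedQuot {A : Type u} [CommRing A] {V : Submodule A (Fin 6 → A)}
    (hV : IsLocallyFreeOfRank A ((Fin 6 → A) ⧸ V) 2) (d : ℕ) :
    IsLocallyFreeOfRank A (gradedQuot (formIdeal V) d) (d + 1) := by
  have := hV.2.1
  obtain ⟨F, hF, rfl⟩ := exists_isIdempotentElem_of_projective V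
  have := projective_quotient_imageOf hF
  have hproj := projective_gradedQuot hF d
  refine ⟨inferInstance, hproj, fun p => ?_⟩
  have hF' := congrArg (fun M => M.map (algebraMap A p.asIdeal.ResidueField)) hF
  rw [Matrix.map_mul] at hF'
  have hbc := isBaseChange_quotSpanMap (isBaseChange_mapForms A p.asIdeal.ResidueField d)
    (formsIn (formIdeal (imageOf F)) d)
  -- The rank at `p` is the dimension over the residue field, where the degree `d` part is again
  -- that of an ideal of linear forms.
  rw [rankAtStalk_eq_finrank_of_isBaseChange p hbc, ← formsIn_map hF]
  refine finrank_gradedQuot hF' ?_ d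
  have h1 := rank_one_sub hF'
  have h2 := (isLocallyFreeOfRank_quotient_imageOf_iff hF 2).1 hV p
  omega

/-! ### The ideal of a plane -/

/-- The linear form `M ↦ (M v)_k`. -/
noncomputable def rowForm {A : Type*} [CommRing A] (k : Fin 2) (v : Fin 6 → A) :
    MvPolynomial (Fin 2 × Fin 6) A :=
  ∑ j, MvPolynomial.X (k, j) * MvPolynomial.C (v j)

lemma linIdeal_eq {A : Type u} [CommRing A] (V : Submodule A (Fin 6 → A)) :
    linIdeal V = Ideal.span {f | ∃ v ∈ V, ∃ k : Fin 2, f = rowForm k v} := rfl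

lemma rowForm_mem {A : Type u} [CommRing A] {V : Submodule A (Fin 6 → A)} {v : Fin 6 → A}
    (hv : v ∈ V) (k : Fin 2) : rowForm k v ∈ linIdeal V :=
  Ideal.subset_span ⟨v, hv, k, rfl⟩

lemma rowForm_add {A : Type*} [CommRing A] (k : Fin 2) (v w : Fin 6 → A) :
    rowForm k (v + w) = rowForm k v + rowForm k w := by
  simp [rowForm, mul_add, Finset.sum_add_distrib]

lemma rowForm_smul {A : Type*} [CommRing A] (k : Fin 2) (a : A) (v : Fin 6 → A) :
    rowForm k (a • v) = MvPolynomial.C a * rowForm k v := by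
  simp only [rowForm, Pi.smul_apply, smul_eq_mul, map_mul, Finset.mul_sum]
  refine Finset.sum_congr rfl fun j _ => ?_
  ring

lemma rowForm_single {A : Type*} [CommRing A] (k : Fin 2) (j : Fin 6) :
    rowForm k (Pi.single j (1 : A)) = MvPolynomial.X (k, j) := by
  rw [rowForm, Finset.sum_eq_single j]
  · simp
  · intro i _ hi
    simp [hi]
  · simp

lemma rowHom_linForm {A : Type*} [CommRing A] (v : Fin 6 → A) :
    rowHom A (linForm A v) = rowForm 0 v := by
  rw [linForm_apply, map_sum]
  refine Finset.sum_congr rfl fun j _ => ?_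
  rw [map_mul, rowHom, MvPolynomial.aeval_X, MvPolynomial.algHom_C, MvPolynomial.algebraMap_eq,
    mul_comm]

lemma seg_rowForm {A B : Type*} [CommRing A] [CommRing B] [Algebra A B] (b : Fin 6 → B)
    (k : Fin 2) (v : Fin 6 → A) :
    seg A b (rowForm k v) = MvPolynomial.X k * MvPolynomial.C (MvPolynomial.aeval b (linForm A v)) := by
  rw [linForm_apply, rowForm]
  simp only [map_sum, map_mul, seg, MvPolynomial.aeval_X, MvPolynomial.algHom_C, Finset.mul_sum,
    MvPolynomial.algebraMap_apply]
  refine Finset.sum_congr rfl fun j _ => ?_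
  ring

lemma substMat_rowForm {A : Type*} [CommRing A] [Algebra ℂ A] (h : Matrix (Fin 2) (Fin 2) ℂ)
    (k : Fin 2) (v : Fin 6 → A) : substMat A h (rowForm k v) =
      ∑ l, MvPolynomial.C (algebraMap ℂ A (h k l)) * rowForm l v := by
  simp only [rowForm, substMat, map_sum, map_mul, MvPolynomial.aeval_X, MvPolynomial.algHom_C,
    MvPolynomial.algebraMap_eq, Finset.sum_mul, Finset.mul_sum]
  rw [Finset.sum_comm]
  refine Finset.sum_congr rfl fun l _ => Finset.sum_congr rfl fun j _ => ?_
  ring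

/-- Hence minors are `SL₂`-invariant and have weight two under scalars. -/
lemma substMat_minor {A : Type u} [CommRing A] [Algebra ℂ A] (h : Matrix (Fin 2) (Fin 2) ℂ)
    (i j : Fin 6) : substMat A h (minor A i j) =
      MvPolynomial.C (algebraMap ℂ A h.det) * minor A i j := by
  simp only [minor_eq, substMat, map_sub, map_mul, MvPolynomial.aeval_X, Fin.sum_univ_two,
    Matrix.det_fin_two]
  ring

lemma isConical_of_substMat {A : Type u} [CommRing A] [Algebra ℂ A] {I : Ideal (CoordRing A)}
    (h : ∀ h : Matrix (Fin 2) (Fin 2) ℂ, I ≤ I.comap (substMat A h)) : IsConical I := by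
  have hle : ∀ t : ℂˣ, I.map (scaleAct A t) ≤ I := fun t => by
    rw [Ideal.map_le_iff_le_comap, scaleAct_eq]
    exact h _
  refine ⟨fun g => by rw [slAct_eq]; exact h _, fun t => le_antisymm (hle t) fun f hf => ?_⟩
  have h1 : scaleAct A t (scaleAct A t⁻¹ f) = f := by
    rw [← AlgHom.mul_apply, ← map_mul, mul_inv_cancel, map_one, AlgHom.one_apply]
  rw [← h1]
  exact Ideal.mem_map_of_mem _ (hle t⁻¹ (Ideal.mem_map_of_mem _ hf))

lemma planeIdeal_eq {A : Type u} [CommRing A] (U : Submodule A (Fin 6 → A)) :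
    planeIdeal U = linIdeal ((formQ A).orthogonal U) ⊔ minorIdeal A := rfl

lemma minorIdeal_le_planeIdeal {A : Type u} [CommRing A] (U : Submodule A (Fin 6 → A)) :
    minorIdeal A ≤ planeIdeal U :=
  le_sup_right

lemma isConical_planeIdeal {A : Type u} [CommRing A] [Algebra ℂ A] (U : Submodule A (Fin 6 → A)) :
    IsConical (planeIdeal U) := by
  refine isConical_of_substMat fun h => ?_
  rw [planeIdeal_eq, sup_le_iff]
  constructor
  · rw [linIdeal_eq, Ideal.span_le]
    rintro _ ⟨v, hv, k, rfl⟩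
    rw [SetLike.mem_coe, Ideal.mem_comap, substMat_rowForm]
    exact Ideal.sum_mem _ fun l _ => Ideal.mul_mem_left _ _
      (Ideal.mem_sup_left (rowForm_mem hv l))
  · rw [minorIdeal, Ideal.span_le]
    rintro _ ⟨i, j, rfl⟩
    rw [SetLike.mem_coe, Ideal.mem_comap, substMat_minor]
    exact Ideal.mul_mem_left _ _ (Ideal.mem_sup_right (minor_mem A i j))

/-- When the forms of `U^⊥` vanish at `b`, the matrices `w bᵗ` lie in the subscheme of `planeIdeal
U`. It is applied to the generic such `b` and to `b = Q u` with `u ∈ U`. -/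
lemma seg_eq_zero_of_mem_planeIdeal {A : Type u} {B : Type*} [CommRing A] [CommRing B]
    [Algebra A B] {b : Fin 6 → B} {U : Submodule A (Fin 6 → A)}
    (hb : ∀ v ∈ (formQ A).orthogonal U, MvPolynomial.aeval b (linForm A v) = 0)
    {f : CoordRing A} (hf : f ∈ planeIdeal U) : seg A b f = 0 := by
  have : planeIdeal U ≤ RingHom.ker (seg A b) := by
    rw [planeIdeal_eq, sup_le_iff]
    constructor
    · rw [linIdeal_eq, Ideal.span_le]
      rintro _ ⟨v, hv, k, rfl⟩
      rw [SetLike.mem_coe, RingHom.mem_ker, seg_rowForm, hb v hv, map_zero, mul_zero]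
    · rw [minorIdeal, Ideal.span_le]
      rintro _ ⟨i, j, rfl⟩
      exact seg_minor b i j
  exact this hf

lemma evalAt_seg_rowHom {A B : Type*} [CommRing A] [CommRing B] [Algebra ℂ B] [Algebra A B]
    (b : Fin 6 → B) (c : MvPolynomial (Fin 6) A) :
    evalAt ![1, 0] (seg A b (rowHom A c)) = MvPolynomial.aeval b c := by
  have : ((evalAt (B := B) ![1, 0]).restrictScalars A).comp ((seg A b).comp (rowHom A)) =
      MvPolynomial.aeval b := by
    refine MvPolynomial.algHom_ext fun j => ?_
    simp [evalAt, seg, rowHom]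
  exact DFunLike.congr_fun this c

/-- Evaluation at the generic point with `w = (1, 0)` returns a polynomial in the first row modulo
the linear forms, so the minors contribute nothing. -/
lemma rowIdeal_planeIdeal {A : Type u} [CommRing A] [Algebra ℂ A] (U : Submodule A (Fin 6 → A)) :
    rowIdeal (planeIdeal U) = formIdeal ((formQ A).orthogonal U) := by
  refine le_antisymm (fun c hc => ?_) (Ideal.span_le.2 ?_)
  · have h1 := seg_eq_zero_of_mem_planeIdeal (b := genPt (formIdeal ((formQ A).orthogonal U)))
      (fun v hv => by
        rw [aeval_genPt]
        exact Ideal.Quotient.eq_zero_iff_mem.2 (linForm_mem_formIdeal hv)) hc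
    have h2 := evalAt_seg_rowHom (genPt (formIdeal ((formQ A).orthogonal U))) c
    rw [h1, map_zero, aeval_genPt] at h2
    exact Ideal.Quotient.eq_zero_iff_mem.1 h2.symm
  · rintro _ ⟨v, hv, rfl⟩
    rw [SetLike.mem_coe, Ideal.mem_comap, rowHom_linForm]
    exact Ideal.mem_sup_left (rowForm_mem hv 0)

lemma linForm_injective (A : Type*) [CommRing A] : Function.Injective (linForm A) := by
  intro v w h
  ext j
  have := congrArg (MvPolynomial.coeff (Finsupp.single j 1)) h
  simpa [linForm_apply, MvPolynomial.coeff_sum, MvPolynomial.coeff_C_mul,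
    MvPolynomial.coeff_X, Finsupp.single_left_inj] using this

lemma linForm_mem_formIdeal_iff {A : Type*} [CommRing A] (V : Submodule A (Fin 6 → A))
    [Module.Projective A ((Fin 6 → A) ⧸ V)] (v : Fin 6 → A) :
    linForm A v ∈ formIdeal V ↔ v ∈ V := by
  refine ⟨fun h => ?_, linForm_mem_formIdeal⟩
  obtain ⟨F, hF, rfl⟩ := exists_isIdempotentElem_of_projective V
  rw [mem_formIdeal_iff hF, linSubst_linForm, ← map_zero (linForm A)] at h
  have := linForm_injective A h
  rw [Matrix.sub_mulVec, Matrix.one_mulVec, sub_eq_zero] at this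
  exact (mem_imageOf_iff hF v).2 this.symm

lemma orthogonal_isLocallyFree {A : Type u} [CommRing A] {U : Submodule A (Fin 6 → A)}
    (hU : U ∈ planes A) : IsLocallyFreeOfRank A ((Fin 6 → A) ⧸ (formQ A).orthogonal U) 2 :=
  isLocallyFreeOfRank_quotient_orthogonal hU rfl

/-- The linear forms contained in the row ideal recover `U^⊥`, and the double complement recovers
`U`. -/
lemma injOn_planeIdeal (A : Type u) [CommRing A] [Algebra ℂ A] :
    Set.InjOn planeIdeal (planes A) := by
  intro U hU U' hU' h
  have h1 : formIdeal ((formQ A).orthogonal U) = formIdeal ((formQ A).orthogonal U') := by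
    rw [← rowIdeal_planeIdeal, ← rowIdeal_planeIdeal, h]
  have i1 : Module.Projective A ((Fin 6 → A) ⧸ U) := hU.2.1
  have i2 : Module.Projective A ((Fin 6 → A) ⧸ U') := hU'.2.1
  have i3 := (orthogonal_isLocallyFree hU).2.1
  have i4 := (orthogonal_isLocallyFree hU').2.1
  rw [← orthogonal_orthogonal U, ← orthogonal_orthogonal U']
  congr 1
  ext v
  rw [← linForm_mem_formIdeal_iff, h1, linForm_mem_formIdeal_iff]

lemma planeIdeal_mem_slHilbFixed {A : Type u} [CommRing A] [Algebra ℂ A]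
    {U : Submodule A (Fin 6 → A)} (hU : U ∈ planes A) : planeIdeal U ∈ slHilbFixed ⊥ A := by
  have hI := isConical_planeIdeal U
  refine ⟨⟨by rw [Ideal.map_bot]; exact bot_le, hI.slStable, fun d => ?_⟩, hI.map_scaleAct⟩
  obtain ⟨e⟩ := hI.nonempty_covariants_equiv (minorIdeal_le_planeIdeal U) d
  refine IsLocallyFreeOfRank.of_equiv ?_ e.symm
  rw [rowIdeal_planeIdeal]
  exact isLocallyFreeOfRank_gradedQuot (orthogonal_isLocallyFree hU) d

/-! ### Fixed points of the Hilbert scheme -/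

/-- The algebra of invariants of `A[X] / I`. -/
noncomputable def invariants {A : Type u} [CommRing A] [Algebra ℂ A] (I : Ideal (CoordRing A))
    (hI : SlStable I) : Subalgebra A (CoordRing A ⧸ I) where
  carrier := {x | ∀ g, slActQuot I hI g x = x}
  mul_mem' hx hy g := by rw [map_mul, hx g, hy g]
  add_mem' hx hy g := by rw [map_add, hx g, hy g]
  algebraMap_mem' a g := AlgHom.commutes _ a

lemma eq_C_of_binForm_zero (p : BinForm 0) :
    (p : MvPolynomial (Fin 2) ℂ) = MvPolynomial.C (MvPolynomial.coeff 0 p.1) :=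
  MvPolynomial.totalDegree_eq_zero_iff_eq_C.1 (MvPolynomial.IsHomogeneous.totalDegree_le p.2 |>.antisymm
    (Nat.zero_le _))

/-- The covariants of type `V_0` are the invariants. -/
noncomputable def covariantsZeroEquiv {A : Type u} [CommRing A] [Algebra ℂ A]
    (I : Ideal (CoordRing A)) (hI : SlStable I) : covariants I hI 0 ≃ₗ[A] invariants I hI where
  toFun φ := ⟨φ.1 ⟨1, MvPolynomial.isHomogeneous_one _ _⟩, fun g => by
    rw [← φ.2]
    congr 1
    exact Subtype.ext (map_one (binAct g))⟩
  map_add' φ ψ := rfl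
  map_smul' a φ := rfl
  invFun x := ⟨((LinearMap.toSpanSingleton ℂ (CoordRing A ⧸ I) x.1).comp
      (MvPolynomial.lcoeff ℂ 0)).comp (Submodule.subtype _), fun g p => by
    have h1 : (binRep 0 g p : MvPolynomial (Fin 2) ℂ) = p := by
      change binAct g p.1 = p.1
      rw [eq_C_of_binForm_zero p, MvPolynomial.algHom_C, MvPolynomial.algebraMap_eq]
    have h2 : binRep 0 g p = p := Subtype.ext h1
    rw [h2]
    change _ = slActQuot I hI g (MvPolynomial.coeff 0 p.1 • x.1)
    rw [← algebraMap_smul A (MvPolynomial.coeff 0 p.1) x.1, map_smul, x.2 g, algebraMap_smul]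
    rfl⟩
  left_inv φ := by
    refine Subtype.ext (LinearMap.ext fun p => ?_)
    change MvPolynomial.coeff 0 p.1 • φ.1 _ = φ.1 p
    rw [← map_smul]
    congr 1
    refine Subtype.ext ?_
    conv_rhs => rw [eq_C_of_binForm_zero p]
    change MvPolynomial.coeff 0 p.1 • (1 : MvPolynomial (Fin 2) ℂ) = _
    rw [MvPolynomial.smul_eq_C_mul, mul_one]
  right_inv x := by
    refine Subtype.ext ?_
    change MvPolynomial.coeff 0 (1 : MvPolynomial (Fin 2) ℂ) • x.1 = x.1
    rw [MvPolynomial.coeff_zero_one, one_smul]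

/-- The invariants are an `A`-algebra that is locally free of rank one, hence equal to `A`. So a
minor is congruent to a constant, and constants and minors have different weights under scaling. -/
lemma IsConical.minorIdeal_le {A : Type u} [CommRing A] [Algebra ℂ A] {I : Ideal (CoordRing A)}
    (hI : IsConical I) (h0 : IsLocallyFreeOfRank A (covariants I hI.slStable 0) 1) :
    minorIdeal A ≤ I := by
  obtain ⟨i1, i2, h1⟩ := h0.of_equiv (covariantsZeroEquiv I hI.slStable)
  have hbij := (Module.algebraMap_bijective_iff_rankAtStalk
    (R := A) (S := invariants I hI.slStable)).1 (funext h1)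
  rw [minorIdeal, Ideal.span_le]
  rintro _ ⟨i, j, rfl⟩
  have hinv : Ideal.Quotient.mk I (minor A i j) ∈ invariants I hI.slStable := by
    intro g
    change Ideal.Quotient.mk I (slAct A g (minor A i j)) = _
    rw [slAct_eq, substMat_minor, Matrix.SpecialLinearGroup.det_coe, map_one, map_one, one_mul]
  obtain ⟨a, ha⟩ := hbij.2 ⟨_, hinv⟩
  have ha' : Ideal.Quotient.mk I (MvPolynomial.C a) = Ideal.Quotient.mk I (minor A i j) :=
    congrArg Subtype.val ha
  rw [eq_comm, Ideal.Quotient.eq] at ha'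
  -- Scaling by 2 multiplies the minor by 4 and fixes the constant, so three times the minor lies in
  -- `I`. Any nonzero scalar whose square is not one would serve.
  have h2 := hI.substMat_mem (h := (2 : ℂ) • 1) (by simp) ha'
  rw [map_sub, substMat_minor, MvPolynomial.algHom_C, MvPolynomial.algebraMap_eq] at h2
  have h3 := I.mul_mem_left (MvPolynomial.C (algebraMap ℂ A 3⁻¹)) (I.sub_mem h2 ha')
  have h4 : (MvPolynomial.C (algebraMap ℂ A 3⁻¹) * 3 : CoordRing A) = 1 := by
    have : (3 : CoordRing A) = MvPolynomial.C (algebraMap ℂ A 3) :=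
      (map_ofNat ((MvPolynomial.C (σ := Fin 2 × Fin 6)).comp (algebraMap ℂ A)) 3).symm
    rw [this, ← map_mul, ← map_mul]
    simp
  have h5 : (MvPolynomial.C (algebraMap ℂ A ((2 : ℂ) • (1 : Matrix (Fin 2) (Fin 2) ℂ)).det) :
      CoordRing A) = 4 := by
    rw [Matrix.det_smul, Matrix.det_one, Fintype.card_fin]
    norm_num
    exact map_ofNat ((MvPolynomial.C (σ := Fin 2 × Fin 6)).comp (algebraMap ℂ A)) 4
  rw [h5] at h3
  have h6 : minor A i j = MvPolynomial.C (algebraMap ℂ A 3⁻¹) *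
      (4 * minor A i j - MvPolynomial.C a - (minor A i j - MvPolynomial.C a)) := by
    linear_combination (-minor A i j) * h4
  rw [SetLike.mem_coe, h6]
  exact h3

lemma isHomogeneous_linForm {A : Type*} [CommRing A] (v : Fin 6 → A) :
    (linForm A v).IsHomogeneous 1 := by
  rw [linForm_apply]
  exact MvPolynomial.IsHomogeneous.sum _ _ _ fun i _ =>
    zero_add 1 ▸ (MvPolynomial.isHomogeneous_C _ (v i)).mul (MvPolynomial.isHomogeneous_X A i)

lemma exists_linForm_eq {A : Type*} [CommRing A] {c : MvPolynomial (Fin 6) A}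
    (hc : c.IsHomogeneous 1) : ∃ v, linForm A v = c := by
  have h1 : c ∈ MvPolynomial.homogeneousSubmodule (Fin 6) A 1 := hc
  rw [MvPolynomial.homogeneousSubmodule_one_eq_span_X, ← Fintype.range_linearCombination] at h1
  exact h1

lemma isLocallyFreeOfRank_of_gradedQuot_one {A : Type u} [CommRing A]
    {N : Ideal (MvPolynomial (Fin 6) A)} {n : ℕ} (h : IsLocallyFreeOfRank A (gradedQuot N 1) n) :
    IsLocallyFreeOfRank A ((Fin 6 → A) ⧸ (N.restrictScalars A).comap (linForm A)) n := by
  let L : (Fin 6 → A) →ₗ[A] gradedQuot N 1 :=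
    (formsIn N 1).mkQ.comp ((linForm A).codRestrict _ isHomogeneous_linForm)
  have hker : LinearMap.ker L = (N.restrictScalars A).comap (linForm A) := by
    ext v
    exact Submodule.Quotient.mk_eq_zero _
  have hL : Function.Surjective L := by
    refine (formsIn N 1).mkQ_surjective.comp ?_
    rintro ⟨c, hc⟩
    obtain ⟨v, hv⟩ := exists_linForm_eq hc
    exact ⟨v, Subtype.ext hv⟩
  exact h.of_equiv ((L.quotKerEquivOfSurjective hL).symm.trans (Submodule.quotEquivOfEq _ _ hker))

/-- The inclusion of ideals induces a surjection of quotients in degree `d`; equality of ranks makes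
it injective. -/
lemma formsIn_eq_of_le {A : Type u} [CommRing A] {N N' : Ideal (MvPolynomial (Fin 6) A)}
    (hle : N' ≤ N) {d n : ℕ} (h : IsLocallyFreeOfRank A (gradedQuot N d) n)
    (h' : IsLocallyFreeOfRank A (gradedQuot N' d) n) : formsIn N d ≤ formsIn N' d := by
  have hle' : formsIn N' d ≤ formsIn N d := fun c hc => hle hc
  have hb := h'.bijective_of_surjective h (φ := (formsIn N' d).liftQ (formsIn N d).mkQ
    (by rw [Submodule.ker_mkQ]; exact hle')) (by
      rintro x
      obtain ⟨c, rfl⟩ := (formsIn N d).mkQ_surjective x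
      exact ⟨(formsIn N' d).mkQ c, rfl⟩)
  intro c hc
  rw [← Submodule.Quotient.mk_eq_zero]
  refine hb.1 ?_
  rw [map_zero]
  exact (Submodule.Quotient.mk_eq_zero _).2 hc

/-- The linear forms `V` in the row ideal already generate an ideal with the prescribed ranks in
every degree, which leaves no room for further equations. -/
lemma exists_planeIdeal_eq {A : Type u} [CommRing A] [Algebra ℂ A] {I : Ideal (CoordRing A)}
    (h : I ∈ slHilbFixed ⊥ A) : ∃ U ∈ planes A, planeIdeal U = I := by
  obtain ⟨⟨-, hs, hcov⟩, ht⟩ := h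
  have hI : IsConical I := ⟨hs, ht⟩
  have hm := hI.minorIdeal_le (hcov 0)
  have hN : ∀ d, IsLocallyFreeOfRank A (gradedQuot (rowIdeal I) d) (d + 1) := fun d =>
    (hcov d).of_equiv (hI.nonempty_covariants_equiv hm d).some
  set V := ((rowIdeal I).restrictScalars A).comap (linForm A) with hVdef
  have hV : IsLocallyFreeOfRank A ((Fin 6 → A) ⧸ V) 2 :=
    isLocallyFreeOfRank_of_gradedQuot_one (hN 1)
  have hproj := hV.2.1
  refine ⟨(formQ A).orthogonal V, isLocallyFreeOfRank_quotient_orthogonal hV rfl, ?_⟩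
  have hrow : rowIdeal (planeIdeal ((formQ A).orthogonal V)) = formIdeal V := by
    rw [rowIdeal_planeIdeal, orthogonal_orthogonal]
  have hle : formIdeal V ≤ rowIdeal I := by
    refine Ideal.span_le.2 ?_
    rintro _ ⟨v, hv, rfl⟩
    exact hv
  ext f
  rw [(isConical_planeIdeal _).mem_iff (minorIdeal_le_planeIdeal _), hI.mem_iff hm,
    seg_genPt_eq_zero_iff, seg_genPt_eq_zero_iff, hrow]
  -- Only homogeneous coefficients occur, so a comparison of the two row ideals degree by degree
  -- suffices.
  refine forall_congr' fun m => ⟨fun h => hle h, fun h => ?_⟩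
  exact formsIn_eq_of_le hle (hN m.degree) (isLocallyFreeOfRank_gradedQuot hV m.degree)
    (show (⟨_, isHomogeneous_coeff_seg A f m⟩ : MvPolynomial.homogeneousSubmodule _ _ _) ∈
      formsIn (rowIdeal I) m.degree from h)

lemma bijOn_planeIdeal (A : Type u) [CommRing A] [Algebra ℂ A] :
    Set.BijOn planeIdeal (planes A) (slHilbFixed ⊥ A) :=
  ⟨fun _ hU => planeIdeal_mem_slHilbFixed hU, injOn_planeIdeal A, fun _ h => exists_planeIdeal_eq h⟩

/-! ### The zero fibre of the moment map -/

/-- The entries of the moment map. -/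
noncomputable def muEntry (A : Type u) [CommRing A] (k l : Fin 2) : CoordRing A :=
  (genMat A * matQ (CoordRing A) * (genMat A)ᵀ * matJ (CoordRing A)) k l

lemma matJ_map {A B : Type*} [CommRing A] [CommRing B] (f : A →+* B) :
    (matJ A).map f = matJ B := by
  ext i j
  fin_cases i <;> fin_cases j <;> simp [matJ]

lemma map_muEntry {A : Type*} {B : Type u} [CommRing A] [CommRing B] (f : A →+* B) (k l : Fin 2) :
    MvPolynomial.map f (muEntry A k l) = muEntry B k l := by
  have hX : (genMat A).map (MvPolynomial.map f) = genMat B := by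
    ext i j
    simp
  have h : (genMat A * matQ (CoordRing A) * (genMat A)ᵀ * matJ (CoordRing A)).map
      (MvPolynomial.map f) =
      genMat B * matQ (CoordRing B) * (genMat B)ᵀ * matJ (CoordRing B) := by
    rw [Matrix.map_mul, Matrix.map_mul, Matrix.map_mul, Matrix.transpose_map, matQ_map, matJ_map,
      hX]
  exact congrFun (congrFun h k) l

lemma map_muIdeal_le_iff {A : Type u} [CommRing A] [Algebra ℂ A] (I : Ideal (CoordRing A)) :
    muIdeal.map (MvPolynomial.map (algebraMap ℂ A)) ≤ I ↔ ∀ k l, muEntry A k l ∈ I := by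
  rw [muIdeal, Ideal.map_span, Ideal.span_le]
  constructor
  · intro h k l
    rw [← map_muEntry (algebraMap ℂ A)]
    exact h ⟨_, ⟨k, l, rfl⟩, rfl⟩
  · rintro h _ ⟨_, ⟨k, l, rfl⟩, rfl⟩
    have := h k l
    rwa [← map_muEntry (algebraMap ℂ A)] at this

lemma formQ_self {A : Type*} [CommRing A] (u : Fin 6 → A) :
    formQ A u u = 2 * (u 0 * u 3 + u 1 * u 4 + u 2 * u 5) := by
  rw [formQ_apply]
  simp [matQ, Matrix.mulVec, dotProduct, Fin.sum_univ_succ]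
  ring

lemma formQ_comm {A : Type*} [CommRing A] (u v : Fin 6 → A) : formQ A u v = formQ A v u := by
  rw [formQ_apply, formQ_apply, Matrix.dotProduct_mulVec, dotProduct_comm,
    ← Matrix.mulVec_transpose, matQ_transpose]

/-- Multiplication by `J` moves the entry `(0, 0)` of `X Q Xᵗ` to position `(0, 1)`: this is the
quadratic form on the first row, which alone detects isotropy. -/
lemma muEntry_zero_one (A : Type u) [CommRing A] : muEntry A 0 1 =
    2 * (MvPolynomial.X (0, 0) * MvPolynomial.X (0, 3) +
      MvPolynomial.X (0, 1) * MvPolynomial.X (0, 4) +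
      MvPolynomial.X (0, 2) * MvPolynomial.X (0, 5)) := by
  simp [muEntry, matQ, matJ, Matrix.mul_apply, Fin.sum_univ_succ]
  ring

lemma isIsotropic_imageOf_iff {A : Type*} [CommRing A] (P : Matrix (Fin 6) (Fin 6) A) :
    IsIsotropic (imageOf P) ↔ adjQ P * P = 0 := by
  constructor
  · intro h
    refine Matrix.ext_of_mulVec_single fun j => ?_
    rw [Matrix.zero_mulVec, ← Matrix.mulVec_mulVec]
    refine eq_zero_of_formQ fun v => ?_
    rw [← formQ_mulVec]
    exact h _ ⟨v, rfl⟩ _ ⟨_, rfl⟩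
  · rintro h _ ⟨v, rfl⟩ _ ⟨w, rfl⟩
    rw [Matrix.mulVecLin_apply, Matrix.mulVecLin_apply, formQ_mulVec, Matrix.mulVec_mulVec, h,
      Matrix.zero_mulVec, map_zero]

/-- At the matrix with first row `Q u` and second row zero, the entry `(0, 1)` equals `⟨u, u⟩`, as
`Q` is an isometry. Polarisation finishes, because 2 is invertible. -/
lemma isIsotropic_of_muEntry_mem {A : Type u} [CommRing A] [Algebra ℂ A]
    {U : Submodule A (Fin 6 → A)} (h : ∀ k l, muEntry A k l ∈ planeIdeal U) : IsIsotropic U := by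
  have h2 : IsUnit (2 : A) := by
    have := (IsUnit.mk0 (2 : ℂ) two_ne_zero).map (algebraMap ℂ A)
    rwa [map_ofNat] at this
  have hself : ∀ u ∈ U, formQ A u u = 0 := by
    intro u hu
    -- The linear form of `v` takes the value `⟨u, v⟩` at `Q u`.
    have hb : ∀ v ∈ (formQ A).orthogonal U,
        MvPolynomial.aeval (matQ A *ᵥ u) (linForm A v) = 0 := by
      intro v hv
      rw [← (LinearMap.BilinForm.mem_orthogonal_iff.1 hv) u hu, formQ_comm, formQ_apply,
        linForm_apply]
      simp [dotProduct]
    have h1 := congrArg (evalAt ![1, 0]) (seg_eq_zero_of_mem_planeIdeal hb (h 0 1))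
    rw [muEntry_zero_one, two_mul] at h1
    simp [seg, evalAt, matQ, Matrix.mulVec, dotProduct, Fin.sum_univ_succ] at h1
    rw [formQ_self, ← h1]
    ring
  intro u hu v hv
  have h1 := hself _ (U.add_mem hu hv)
  simp only [map_add, LinearMap.add_apply, hself u hu, hself v hv, formQ_comm v u, zero_add,
    add_zero, ← two_mul] at h1
  exact (h2.mul_right_eq_zero).1 h1

/-- Modulo the linear forms the generic matrix `Y` kills `U^⊥`, so `Y = Y · adjQ P`. Then `Y Q Yᵗ =
Y · adjQ P · P · Q Yᵗ`, and isotropy is `adjQ P · P = 0`. The minors play no part. -/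
lemma muEntry_mem_of_isIsotropic {A : Type u} [CommRing A] {U : Submodule A (Fin 6 → A)}
    [Module.Projective A ((Fin 6 → A) ⧸ U)] (hU : IsIsotropic U) (k l : Fin 2) :
    muEntry A k l ∈ planeIdeal U := by
  obtain ⟨P, hP, rfl⟩ := exists_isIdempotentElem_of_projective U
  rw [isIsotropic_imageOf_iff] at hU
  let q := Ideal.Quotient.mk (planeIdeal (imageOf P))
  let c : A →+* CoordRing A ⧸ planeIdeal (imageOf P) := q.comp MvPolynomial.C
  let Y := (genMat A).map q
  have hY : Y = Y * adjQ (P.map c) := by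
    have h1 : Y * (1 - adjQ P).map c = 0 := by
      ext i j
      have h2 : rowForm i ((1 - adjQ P) *ᵥ Pi.single j 1) ∈ planeIdeal (imageOf P) := by
        refine Ideal.mem_sup_left (rowForm_mem ?_ i)
        rw [orthogonal_imageOf hP]
        exact ⟨_, rfl⟩
      have h3 := Ideal.Quotient.eq_zero_iff_mem.2 h2
      rw [rowForm, map_sum] at h3
      rw [Matrix.mul_apply, Matrix.zero_apply, ← h3]
      refine Finset.sum_congr rfl fun m _ => ?_
      rw [map_mul, Matrix.mulVec_single_one]
      simp [Y, c, q]
    rw [Matrix.map_sub _ (map_sub _), Matrix.map_one _ (map_zero _) (map_one _), adjQ_map,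
      Matrix.mul_sub, Matrix.mul_one, sub_eq_zero] at h1
    exact h1
  have hzero : adjQ (P.map c) * P.map c = 0 := by
    rw [← adjQ_map, ← Matrix.map_mul, hU, Matrix.map_zero _ (map_zero c)]
  rw [← Ideal.Quotient.eq_zero_iff_mem]
  have h4 : (genMat A * matQ (CoordRing A) * (genMat A)ᵀ * matJ (CoordRing A)).map q =
      Y * matQ (CoordRing A ⧸ planeIdeal (imageOf P)) * Yᵀ *
        matJ (CoordRing A ⧸ planeIdeal (imageOf P)) := by
    rw [Matrix.map_mul, Matrix.map_mul, Matrix.map_mul, Matrix.transpose_map, matQ_map, matJ_map]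
  have h6 : matQ (CoordRing A ⧸ planeIdeal (imageOf P)) * (adjQ (P.map c))ᵀ =
      P.map c * matQ (CoordRing A ⧸ planeIdeal (imageOf P)) := by
    simp only [adjQ, Matrix.transpose_mul, Matrix.transpose_transpose, matQ_transpose]
    rw [← Matrix.mul_assoc, matQ_mul_self, Matrix.one_mul]
  have h5 : Y * matQ (CoordRing A ⧸ planeIdeal (imageOf P)) * Yᵀ = 0 := by
    calc Y * matQ (CoordRing A ⧸ planeIdeal (imageOf P)) * Yᵀ
        = Y * adjQ (P.map c) * matQ (CoordRing A ⧸ planeIdeal (imageOf P)) *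
            (Y * adjQ (P.map c))ᵀ := by rw [← hY]
      _ = Y * (adjQ (P.map c) * ((matQ (CoordRing A ⧸ planeIdeal (imageOf P)) *
            (adjQ (P.map c))ᵀ) * Yᵀ)) := by
          simp only [Matrix.transpose_mul, Matrix.mul_assoc]
      _ = 0 := by
          rw [h6, Matrix.mul_assoc (P.map c), ← Matrix.mul_assoc (adjQ _), hzero, Matrix.zero_mul,
            Matrix.mul_zero]
  have h7 := congrFun (congrFun h4 k) l
  rw [h5, Matrix.zero_mul] at h7
  exact h7

lemma mem_slHilbFixed_muIdeal_iff {A : Type u} [CommRing A] [Algebra ℂ A]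
    (I : Ideal (CoordRing A)) :
    I ∈ slHilbFixed muIdeal A ↔ I ∈ slHilbFixed ⊥ A ∧ ∀ k l, muEntry A k l ∈ I := by
  rw [← map_muIdeal_le_iff]
  constructor
  · rintro ⟨⟨h1, h2⟩, h3⟩
    exact ⟨⟨⟨by rw [Ideal.map_bot]; exact bot_le, h2⟩, h3⟩, h1⟩
  · rintro ⟨⟨⟨-, h2⟩, h3⟩, h1⟩
    exact ⟨⟨h1, h2⟩, h3⟩

lemma planeIdeal_mem_slHilbFixed_muIdeal_iff {A : Type u} [CommRing A] [Algebra ℂ A]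
    {U : Submodule A (Fin 6 → A)} (hU : U ∈ planes A) :
    planeIdeal U ∈ slHilbFixed muIdeal A ↔ IsIsotropic U := by
  have := hU.2.1
  rw [mem_slHilbFixed_muIdeal_iff]
  exact ⟨fun h => isIsotropic_of_muEntry_mem h.2,
    fun h => ⟨planeIdeal_mem_slHilbFixed hU, muEntry_mem_of_isIsotropic h⟩⟩

lemma bijOn_planeIdeal_isoPlanes (A : Type u) [CommRing A] [Algebra ℂ A] :
    Set.BijOn planeIdeal (isoPlanes A) (slHilbFixed muIdeal A) := by
  refine ⟨fun U hU => (planeIdeal_mem_slHilbFixed_muIdeal_iff hU.1).2 hU.2,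
    (injOn_planeIdeal A).mono fun U hU => hU.1, fun I hI => ?_⟩
  obtain ⟨U, hU, rfl⟩ := exists_planeIdeal_eq ((mem_slHilbFixed_muIdeal_iff I).1 hI).1
  exact ⟨U, ⟨hU, (planeIdeal_mem_slHilbFixed_muIdeal_iff hU).1 hI⟩, rfl⟩

/-! ### Base change -/

lemma baseChange_mem_planes {A B : Type u} [CommRing A] [CommRing B] (f : A →+* B)
    {U : Submodule A (Fin 6 → A)} (hU : U ∈ planes A) : baseChange f U ∈ planes B := by
  let := f.toAlgebra
  obtain ⟨φ, hφ⟩ := exists_isBaseChange_quotient A B U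
  exact IsLocallyFreeOfRank.of_isBaseChange hφ hU

lemma isIsotropic_baseChange {A B : Type u} [CommRing A] [CommRing B] (f : A →+* B)
    {U : Submodule A (Fin 6 → A)} [Module.Projective A ((Fin 6 → A) ⧸ U)] (hU : IsIsotropic U) :
    IsIsotropic (baseChange f U) := by
  obtain ⟨P, hP, rfl⟩ := exists_isIdempotentElem_of_projective U
  rw [isIsotropic_imageOf_iff] at hU
  rw [baseChange_imageOf, isIsotropic_imageOf_iff, ← adjQ_map, ← Matrix.map_mul, hU,
    Matrix.map_zero _ (map_zero f)]

lemma map_rowForm {A B : Type*} [CommRing A] [CommRing B] (f : A →+* B) (k : Fin 2)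
    (v : Fin 6 → A) : MvPolynomial.map f (rowForm k v) = rowForm k fun j => f (v j) := by
  simp [rowForm]

lemma linIdeal_baseChange {A B : Type u} [CommRing A] [CommRing B] (f : A →+* B)
    (V : Submodule A (Fin 6 → A)) :
    linIdeal (baseChange f V) = (linIdeal V).map (MvPolynomial.map f) := by
  refine le_antisymm ?_ ?_
  · rw [linIdeal_eq, Ideal.span_le]
    rintro _ ⟨w, hw, k, rfl⟩
    rw [SetLike.mem_coe]
    induction hw using Submodule.span_induction with
    | mem w hw =>
      obtain ⟨v, hv, rfl⟩ := hw
      rw [← map_rowForm]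
      exact Ideal.mem_map_of_mem _ (rowForm_mem hv k)
    | zero => simp [rowForm]
    | add v w _ _ hv hw => exact rowForm_add k v w ▸ Ideal.add_mem _ hv hw
    | smul b v _ hv => exact rowForm_smul k b v ▸ Ideal.mul_mem_left _ _ hv
  · rw [linIdeal_eq V, Ideal.map_span, Ideal.span_le]
    rintro _ ⟨_, ⟨v, hv, k, rfl⟩, rfl⟩
    rw [map_rowForm]
    have hfv : (fun j => f (v j)) ∈ baseChange f V := Submodule.subset_span ⟨v, hv, rfl⟩
    exact rowForm_mem hfv k

lemma map_minor {A B : Type u} [CommRing A] [CommRing B] (f : A →+* B) (i j : Fin 6) :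
    MvPolynomial.map f (minor A i j) = minor B i j := by
  simp [minor_eq]

lemma map_minorIdeal {A B : Type u} [CommRing A] [CommRing B] (f : A →+* B) :
    (minorIdeal A).map (MvPolynomial.map f) = minorIdeal B := by
  rw [minorIdeal, Ideal.map_span, minorIdeal]
  congr 1
  ext g
  simp only [Set.mem_image, Set.mem_ofPred_eq]
  constructor
  · rintro ⟨_, ⟨i, j, rfl⟩, rfl⟩
    exact ⟨i, j, map_minor f i j⟩
  · rintro ⟨i, j, rfl⟩
    exact ⟨_, ⟨i, j, rfl⟩, map_minor f i j⟩

lemma planeIdeal_baseChange {A B : Type u} [CommRing A] [CommRing B] (f : A →+* B)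
    (U : Submodule A (Fin 6 → A)) [Module.Projective A ((Fin 6 → A) ⧸ U)] :
    planeIdeal (baseChange f U) = (planeIdeal U).map (MvPolynomial.map f) := by
  rw [planeIdeal_eq, planeIdeal_eq, Ideal.map_sup, map_minorIdeal, baseChange_orthogonal,
    linIdeal_baseChange]

/-! ### Closed points -/

lemma mem_planes_iff_finrank {K : Type u} [Field K] (U : Submodule K (Fin 6 → K)) :
    U ∈ planes K ↔ Module.finrank K U = 2 := by
  have h1 := U.finrank_quotient_add_finrank
  rw [Module.finrank_fin_fun] at h1
  change IsLocallyFreeOfRank K _ 4 ↔ _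
  rw [isLocallyFreeOfRank_iff_finrank]
  omega

lemma finrank_orthogonal {K : Type u} [Field K] {U : Submodule K (Fin 6 → K)} {n m : ℕ}
    (hU : Module.finrank K U = n) (hnm : n + m = 6) :
    Module.finrank K ((formQ K).orthogonal U) = m := by
  have h1 := U.finrank_quotient_add_finrank
  have h2 := ((formQ K).orthogonal U).finrank_quotient_add_finrank
  rw [Module.finrank_fin_fun] at h1 h2
  have h3 : IsLocallyFreeOfRank K ((Fin 6 → K) ⧸ U) m :=
    isLocallyFreeOfRank_iff_finrank.2 (by omega)
  have h4 := isLocallyFreeOfRank_iff_finrank.1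
    (isLocallyFreeOfRank_quotient_orthogonal h3 (show m + n = 6 by omega))
  omega

/-- Modulo the linear forms every column is a combination of the columns `i` and `j`, so every minor
is a multiple of `minor A i j`. -/
lemma minorIdeal_le_of_sup_eq_top {A : Type u} [CommRing A] {V : Submodule A (Fin 6 → A)}
    {i j : Fin 6} (h : V ⊔ Submodule.span A {Pi.single i 1, Pi.single j 1} = ⊤) :
    minorIdeal A ≤ linIdeal V ⊔ Ideal.span {minor A i j} := by
  set K := linIdeal V ⊔ Ideal.span {minor A i j}
  have key : ∀ m : Fin 6, ∃ a b : A, ∀ k : Fin 2, Ideal.Quotient.mk K (MvPolynomial.X (k, m)) =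
      Ideal.Quotient.mk K (MvPolynomial.C a) * Ideal.Quotient.mk K (MvPolynomial.X (k, i)) +
      Ideal.Quotient.mk K (MvPolynomial.C b) * Ideal.Quotient.mk K (MvPolynomial.X (k, j)) := by
    intro m
    obtain ⟨v, hv, w, hw, hvw⟩ := Submodule.mem_sup.1
      (h ▸ Submodule.mem_top : (Pi.single m 1 : Fin 6 → A) ∈ _)
    obtain ⟨a, b, rfl⟩ := Submodule.mem_span_pair.1 hw
    refine ⟨a, b, fun k => ?_⟩
    have h1 : Ideal.Quotient.mk K (rowForm k v) = 0 :=
      Ideal.Quotient.eq_zero_iff_mem.2 (Ideal.mem_sup_left (rowForm_mem hv k))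
    rw [← rowForm_single k m, ← hvw, rowForm_add, rowForm_add, rowForm_smul, rowForm_smul,
      rowForm_single, rowForm_single, map_add, h1, zero_add, map_add, map_mul, map_mul]
  rw [minorIdeal, Ideal.span_le]
  rintro _ ⟨m, n, rfl⟩
  rw [SetLike.mem_coe, ← Ideal.Quotient.eq_zero_iff_mem, minor_eq]
  obtain ⟨a, b, hm⟩ := key m
  obtain ⟨c, d, hn⟩ := key n
  have h0 : Ideal.Quotient.mk K (minor A i j) = 0 :=
    Ideal.Quotient.eq_zero_iff_mem.2 (Ideal.mem_sup_right (Ideal.subset_span rfl))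
  rw [minor_eq] at h0
  simp only [map_sub, map_mul] at h0 ⊢
  rw [hm, hm, hn, hn]
  -- The multiplier is the determinant `a d - b c` of the coefficients that express the columns `m`
  -- and `n`.
  linear_combination (Ideal.Quotient.mk K (MvPolynomial.C a) * Ideal.Quotient.mk K (MvPolynomial.C d)
    - Ideal.Quotient.mk K (MvPolynomial.C b) * Ideal.Quotient.mk K (MvPolynomial.C c)) * h0

lemma linIdeal_sup_minor_eq {A : Type u} [CommRing A] {V : Submodule A (Fin 6 → A)}
    {i j : Fin 6} (h : V ⊔ Submodule.span A {Pi.single i 1, Pi.single j 1} = ⊤) :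
    linIdeal V ⊔ Ideal.span {minor A i j} = linIdeal V ⊔ minorIdeal A := by
  refine le_antisymm (sup_le_sup_left ?_ _) (sup_le le_sup_left (minorIdeal_le_of_sup_eq_top h))
  rw [Ideal.span_singleton_le_iff_mem]
  exact minor_mem A i j

/-- The standard basis spans the two-dimensional quotient by `V`, so two of its members give a basis
there. -/
lemma exists_sup_span_pair_eq_top {K : Type u} [Field K] {V : Submodule K (Fin 6 → K)}
    (hV : Module.finrank K V = 4) :
    ∃ i j : Fin 6, V ⊔ Submodule.span K {Pi.single i 1, Pi.single j 1} = ⊤ := by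
  let b : Fin 6 → (Fin 6 → K) ⧸ V := fun j => V.mkQ (Pi.single j 1)
  have hspan : Submodule.span K (Set.range b) = ⊤ := by
    have h1 : Set.range b = V.mkQ '' Set.range (Pi.basisFun K (Fin 6)) := by
      rw [← Set.range_comp]
      congr 1
      ext j
      simp [b]
    rw [h1, ← Submodule.map_span, (Pi.basisFun K (Fin 6)).span_eq, Submodule.map_top,
      Submodule.range_mkQ]
  obtain ⟨κ, a, ha, hs, hli⟩ := exists_linearIndependent' K b
  have : Finite κ := Finite.of_injective a ha
  have : Fintype κ := Fintype.ofFinite κ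
  have hcard : Fintype.card κ = 2 := by
    have h1 := V.finrank_quotient_add_finrank
    rw [Module.finrank_fin_fun] at h1
    have h2 := Module.finrank_eq_card_basis
      (Module.Basis.mk hli (by rw [hs, hspan]))
    omega
  let e := Fintype.equivFinOfCardEq hcard
  refine ⟨a (e.symm 0), a (e.symm 1), ?_⟩
  rw [← Submodule.map_mkQ_eq_top, Submodule.map_span, Set.image_pair, eq_top_iff, ← hspan, ← hs,
    Submodule.span_le]
  rintro _ ⟨x, rfl⟩
  obtain ⟨y, rfl⟩ := e.symm.surjective x
  refine Submodule.subset_span ?_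
  fin_cases y
  · exact Or.inl rfl
  · exact Or.inr rfl

/-- The planes are reparametrised by `V = U^⊥`, which the double complement makes bijective. -/
lemma mem_slHilbFixed_iff_exists (I : Ideal (CoordRing ℂ)) : I ∈ slHilbFixed ⊥ ℂ ↔
    ∃ V : Submodule ℂ (Fin 6 → ℂ), Module.finrank ℂ V = 4 ∧
      ∃ i j : Fin 6, V ⊔ Submodule.span ℂ {Pi.single i 1, Pi.single j 1} = ⊤ ∧
        I = linIdeal V ⊔ Ideal.span {minor ℂ i j} := by
  constructor
  · intro h
    obtain ⟨U, hU, rfl⟩ := exists_planeIdeal_eq h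
    have hV := finrank_orthogonal (m := 4) ((mem_planes_iff_finrank U).1 hU) rfl
    obtain ⟨i, j, hij⟩ := exists_sup_span_pair_eq_top hV
    exact ⟨_, hV, i, j, hij, (linIdeal_sup_minor_eq hij).symm⟩
  · rintro ⟨V, hV, i, j, hij, rfl⟩
    rw [linIdeal_sup_minor_eq hij, ← orthogonal_orthogonal V]
    exact planeIdeal_mem_slHilbFixed
      ((mem_planes_iff_finrank _).2 (finrank_orthogonal hV rfl))

lemma mem_slHilbFixed_muIdeal_iff_exists (I : Ideal (CoordRing ℂ)) :
    I ∈ slHilbFixed muIdeal ℂ ↔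
    ∃ V : Submodule ℂ (Fin 6 → ℂ), Module.finrank ℂ V = 4 ∧
      IsIsotropic ((formQ ℂ).orthogonal V) ∧
      ∃ i j : Fin 6, V ⊔ Submodule.span ℂ {Pi.single i 1, Pi.single j 1} = ⊤ ∧
        I = linIdeal V ⊔ Ideal.span {minor ℂ i j} := by
  have key : ∀ (V : Submodule ℂ (Fin 6 → ℂ)), Module.finrank ℂ V = 4 → ∀ i j : Fin 6,
      V ⊔ Submodule.span ℂ {Pi.single i 1, Pi.single j 1} = ⊤ →
      (linIdeal V ⊔ Ideal.span {minor ℂ i j} ∈ slHilbFixed muIdeal ℂ ↔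
        IsIsotropic ((formQ ℂ).orthogonal V)) := by
    intro V hV i j hij
    rw [← planeIdeal_mem_slHilbFixed_muIdeal_iff
      ((mem_planes_iff_finrank _).2 (finrank_orthogonal hV rfl)), planeIdeal_eq,
      orthogonal_orthogonal, linIdeal_sup_minor_eq hij]
  constructor
  · intro h
    obtain ⟨V, hV, i, j, hij, rfl⟩ :=
      (mem_slHilbFixed_iff_exists I).1 ((mem_slHilbFixed_muIdeal_iff I).1 h).1
    exact ⟨V, hV, (key V hV i j hij).1 h, i, j, hij, rfl⟩
  · rintro ⟨V, hV, hiso, i, j, hij, rfl⟩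
    exact (key V hV i j hij).2 hiso

end SlTwoHilb

open SlTwoHilb in
theorem mainTheorem5 :
    (∀ (A : Type u) [CommRing A] [Algebra ℂ A],
      Set.BijOn planeIdeal (planes A) (slHilbFixed ⊥ A) ∧
      Set.BijOn planeIdeal (isoPlanes A) (slHilbFixed muIdeal A)) ∧
    (∀ (A B : Type u) [CommRing A] [CommRing B] [Algebra ℂ A] [Algebra ℂ B] (f : A →ₐ[ℂ] B),
      ∀ U ∈ planes A,
        baseChange (f : A →+* B) U ∈ planes B ∧
        (IsIsotropic U → IsIsotropic (baseChange (f : A →+* B) U)) ∧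
        planeIdeal (baseChange (f : A →+* B) U) =
          (planeIdeal U).map (MvPolynomial.map (f : A →+* B))) ∧
    Set.BijOn planeIdeal {U : Submodule ℂ (Fin 6 → ℂ) | Module.finrank ℂ U = 2}
      (slHilbFixed ⊥ ℂ) ∧
    Set.BijOn planeIdeal {U : Submodule ℂ (Fin 6 → ℂ) | Module.finrank ℂ U = 2 ∧ IsIsotropic U}
      (slHilbFixed muIdeal ℂ) ∧
    (∀ I : Ideal (CoordRing ℂ), I ∈ slHilbFixed ⊥ ℂ ↔
      ∃ V : Submodule ℂ (Fin 6 → ℂ), Module.finrank ℂ V = 4 ∧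
        ∃ i j : Fin 6, V ⊔ Submodule.span ℂ {Pi.single i 1, Pi.single j 1} = ⊤ ∧
          I = linIdeal V ⊔ Ideal.span {minor ℂ i j}) ∧
    (∀ I : Ideal (CoordRing ℂ), I ∈ slHilbFixed muIdeal ℂ ↔
      ∃ V : Submodule ℂ (Fin 6 → ℂ), Module.finrank ℂ V = 4 ∧
        IsIsotropic ((formQ ℂ).orthogonal V) ∧
        ∃ i j : Fin 6, V ⊔ Submodule.span ℂ {Pi.single i 1, Pi.single j 1} = ⊤ ∧
          I = linIdeal V ⊔ Ideal.span {minor ℂ i j}) := by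
  have h1 : {U : Submodule ℂ (Fin 6 → ℂ) | Module.finrank ℂ U = 2} = planes ℂ :=
    Set.ext fun U => (mem_planes_iff_finrank U).symm
  have h2 : {U : Submodule ℂ (Fin 6 → ℂ) | Module.finrank ℂ U = 2 ∧ IsIsotropic U} =
      isoPlanes ℂ := Set.ext fun U => and_congr_left' (mem_planes_iff_finrank U).symm
  refine ⟨fun A _ _ => ⟨bijOn_planeIdeal A, bijOn_planeIdeal_isoPlanes A⟩,
    fun A B _ _ _ _ f U hU => ?_, ?_, ?_, mem_slHilbFixed_iff_exists,
    mem_slHilbFixed_muIdeal_iff_exists⟩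
  · have := hU.2.1
    exact ⟨baseChange_mem_planes _ hU, isIsotropic_baseChange _, planeIdeal_baseChange _ U⟩
  · rw [h1]
    exact bijOn_planeIdeal ℂ
  · rw [h2]
    exact bijOn_planeIdeal_isoPlanes ℂ
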